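/- Let $k$ be an algebraically closed field and let $(A_n)_{n\ge 0}$ be a tower of recollement over $k$, i.e. a sequence of finite-dimensional $k$-algebras with idempotents $e_n\in A_n$ ($n\ge 2$) such that: (A1) there are algebra isomorphisms $\Phi_n:A_{n-2}\to e_nA_ne_n$ ($n\ge2$); (A2) $A_0$, $A_1$ and $A_n/A_ne_nA_n$ ($n\ge 2$) are semisimple, and for $0\le t\le n/2$, with $e_{n,0}=1$ and $e_{n,t}=\Phi_n(e_{n-2,t-1})$, the multiplication map $A_ne_{n,t}\otimes_{e_{n,t}A_ne_{n,t}}e_{n,t}A_n\to A_ne_{n,t}A_n$ is bijective; (A3) $A_n$ is a (unital) subalgebra of $A_{n+1}$; (A4) $A_ne_n\cong A_{n-1}$ as a left $A_{n-1}$-, right $A_{n-2}$-bimodule ($n\geq 2$). Let $\Lambda^m$ be the set of isomorphism classes of simple $A_m$-modules killed by $e_m$ (all simple modules if $m\le 1$), and call the elements of $\bigsqcup_m\Lambda^m$ weights. Put $\Lambda_n=\Lambda^n\sqcup\Lambda^{n-2}\sqcup\cdots$. For $\lambda\in\Lambda^m$ the class of $S$ and $n=m+2t$ with $t\ge0$,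 let $\Delta_n(\lambda)=A_ne_{n,t}\otimes_{A_m}S$ be the standard module (where $A_m\cong e_{n,t}A_ne_{n,t}$), $L_n(\lambda)$ its simple head and $P_n(\lambda)$ the projective cover of $L_n(\lambda)$. Write $\mathrm{ind}_nM=A_{n+1}\otimes_{A_n}M$ and let $\mathrm{res}_n$ be restriction from $A_n$ to $A_{n-1}$. The last two axioms are: (A5) for $\lambda\in\Lambda^m\subseteq\Lambda_n$, $n\ge1$, the module $\mathrm{res}_n\Delta_n(\lambda)$ has a filtration by standard modules, and the multiset $\mathrm{supp}_n(\lambda)$ of the labels that occur has all its elements in $\Lambda^{m-1}\sqcup\Lambda^{m+1}$; (A6) for $n\ge 1$ and $\lambda\in\Lambda^n$ there is $\mu\in\Lambda^{n-1}$ with $\lambda\in\mathrm{supp}_{n+1}(\mu)$. The support $\mathrm{supp}(\lambda)$ is the multiset that contains $\mathrm{supp}_n(\lambda)$ as a sub-multiset whenever $\lambda\in\Lambda_n$, with equality whenever $\lambda\in\Lambda_{n-2}$; every statement below about $\mathrm{supp}(\lambda)$ includes that this limit multiset exists. Let $\mathcal B_n(\lambda)$ be the set of $\mu\in\Lambda_n$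 such that $L_n(\mu)$ is in the same block of $A_n$ as $L_n(\lambda)$, and $\mathcal B(\lambda)=\bigcup_n\mathcal B_n(\lambda)$. Let $\mathrm{pr}_n^\lambda$ be the projection onto the block of $A_n$ containing $L_n(\lambda)$, and put $\mathrm{ind}_n^\lambda=\mathrm{pr}^\lambda_{n+1}\mathrm{ind}_n$, $\mathrm{res}_n^\lambda=\mathrm{pr}_{n-1}^\lambda\mathrm{res}_n$. Write $\lambda<\mu$ if $\lambda\in\Lambda_n$ and $\mu\notin\Lambda_n$ for some $n$. Intersections with supports are taken as multisets. A weight $\lambda'$ separates $\lambda^-$ and $\lambda^+$ if $\lambda^-<\lambda^+$, $\mathcal B(\lambda')\cap\mathrm{supp}(\lambda^-)=\{\lambda'\}=\mathcal B(\lambda')\cap\mathrm{supp}(\lambda^+)$ and $\mathcal B(\lambda^-)\cap\mathrm{supp}(\lambda')=\{\lambda^+,\lambda^-\}$. A weight $\lambda'$ is in the lower closure of $\lambda^+$ if $\lambda'<\lambda^+$ and for every $\tau'\in\mathcal B(\lambda')$ there is a weight $\tau^+\in\mathcal B(\lambda^+)$, with $\tau^+=\lambda^+$ if $\tau'=\lambda'$,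 such that either (i) $\mathcal B(\lambda^+)\cap\mathrm{supp}(\tau')=\{\tau^+\}$ and $\mathcal B(\lambda')\cap\mathrm{supp}(\tau^+)=\{\tau'\}$, or (ii) $\tau'$ separates $\tau^-$ and $\tau^+$ for some $\tau^-\in\mathcal B(\lambda^+)$. $\mathcal B(\lambda^+)$ has enough local homomorphisms with respect to $\mathcal B(\lambda')$ if for all $\mu^-,\mu^+\in\mathcal B(\lambda^+)$ separated by some $\mu'\in\mathcal B(\lambda')$ one has $\mathrm{Hom}_{A_n}(\Delta_n(\mu^+),\Delta_n(\mu^-))\ne0$ for some $n$ with $\mu^-,\mu^+\in\Lambda_n$ (whether this holds does not depend on such $n$). **Proposition.** Suppose that $\mathcal B(\lambda^+)$ has enough local homomorphisms with respect to $\mathcal B(\lambda')$ and that $\lambda'$ is in the lower closure of $\lambda^+$. Then for every $n$ with $\lambda'\in\Lambda_n$ we have $\lambda^+\in\Lambda_{n+1}$ and $$\mathrm{ind}_n^{\lambda^+}P_n(\lambda')\cong P_{n+1}(\lambda^+).$$ If moreover $n\ge 2$ and $\lambda'\in\Lambda_{n-2}$, then $\lambda^+\in\Lambda_{n-1}$ and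 $$\mathrm{res}_n^{\lambda^+}P_n(\lambda')\cong P_{n-1}(\lambda^+).$$ -/

import Mathlib

open scoped TensorProduct

universe u v w

namespace Recollement

/-! ### Change of rings along a (possibly non-unital) algebra map -/

section ChangeOfRings

variable {k : Type w} [Field k] {B : Type u} {A : Type u} [Ring B] [Algebra k B] [Ring A]
  [Algebra k A]

/-- The relations `a φ(b) ⊗ x = a ⊗ b x` in `A ⊗ₖ M`. -/
def balancedRel (φ : B →ₙₐ[k] A) (M : Type v) [AddCommGroup M] [Module k M] [Module B M] :
    Submodule A (A ⊗[k] M) :=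
  Submodule.span A
    {z | ∃ (a : A) (b : B) (x : M), z = (a * φ b) ⊗ₜ[k] x - a ⊗ₜ[k] (b • x)}

/-- `A φ(1) ⊗_B M`.  Because `a ⊗ x = a ⊗ 1 x = a φ(1) ⊗ x` in this quotient, one gets `A ⊗_B M`
(induction) if `φ` is unital, and the globalisation `A e ⊗_{eAe} M` if `φ` is an
isomorphism of `B` onto the corner `e A e`. -/
abbrev Extend (φ : B →ₙₐ[k] A) (M : Type v) [AddCommGroup M] [Module k M] [Module B M] :
    Type (max u v) :=
  (A ⊗[k] M) ⧸ balancedRel φ M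

/-- The restriction of an `A`-module along a unital algebra map `φ : B → A`. -/
def Res (_φ : B →ₐ[k] A) (M : Type v) : Type v := M

instance (φ : B →ₐ[k] A) (M : Type v) [h : AddCommGroup M] : AddCommGroup (Res φ M) := h

instance (φ : B →ₐ[k] A) (M : Type v) [AddCommGroup M] [h : Module A M] : Module B (Res φ M) :=
  Module.compHom M φ.toRingHom

end ChangeOfRings

/-! ### Simple modules, projective covers, blocks of one algebra -/

section OneAlgebra

/-- Isomorphism of the simple modules `R / I`, `R / J` for maximal left ideals `I`, `J`. -/
def simpleSetoid (R : Type u) [Ring R] : Setoid {I : Submodule R R // IsCoatom I} where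
  r I J := Nonempty ((R ⧸ I.1) ≃ₗ[R] (R ⧸ J.1))
  iseqv :=
    { refl := fun _ => ⟨LinearEquiv.refl _ _⟩
      symm := fun ⟨f⟩ => ⟨f.symm⟩
      trans := fun ⟨f⟩ ⟨g⟩ => ⟨f.trans g⟩ }

/-- The isomorphism classes of simple left `R`-modules. -/
def SimpleClass (R : Type u) [Ring R] : Type u := Quotient (simpleSetoid R)

/-- A simple module in a given isomorphism class. -/
abbrev SimpleClass.Rep {R : Type u} [Ring R] (c : SimpleClass R) : Type u :=
  R ⧸ (Quotient.out (s := simpleSetoid R) c).1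

/-- `P` is a projective cover of `L`: it is projective and maps onto `L` with superfluous kernel. -/
def IsProjectiveCover (R : Type u) [Ring R] (P : Type v) [AddCommGroup P] [Module R P]
    (L : Type w) [AddCommGroup L] [Module R L] : Prop :=
  Module.Projective R P ∧ ∃ π : P →ₗ[R] L, Function.Surjective π ∧
    ∀ N : Submodule R P, N ⊔ LinearMap.ker π = ⊤ → N = ⊤

/-- The central idempotent `c` acts as the identity on `M` (on a simple module, a central
idempotent acts either as the identity or as zero). -/
def ActsAsOne {R : Type u} [Ring R] (c : R) (M : Type v) [AddCommGroup M] [Module R M] : Prop :=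
  ∀ x : M, c • x = x

/-- Two simple modules are in the same block: the same central idempotents act as the
identity on them. -/
def SameBlock (R : Type u) [Ring R] (M : Type v) [AddCommGroup M] [Module R M]
    (N : Type w) [AddCommGroup N] [Module R N] : Prop :=
  ∀ c : R, c ∈ Subring.center R → IsIdempotentElem c → (ActsAsOne c M ↔ ActsAsOne c N)

/-- The component of `M` in the block that contains the simple module `L`.  For a
finite-dimensional algebra this is `c₀ M`, where `c₀` is the primitive central idempotent acting
as the identity on `L`: the central idempotents acting as the identity on `L` are
those `c` with `c c₀ = c₀`. -/
def blockPart (R : Type u) [Ring R] (L : Type w) [AddCommGroup L] [Module R L]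
    (M : Type v) [AddCommGroup M] [Module R M] : Submodule R M where
  carrier := {x | ∀ c : R, c ∈ Subring.center R → IsIdempotentElem c → ActsAsOne c L → c • x = x}
  zero_mem' := by intro c _ _ _; exact smul_zero c
  add_mem' := by
    intro x y hx hy c h1 h2 h3
    rw [smul_add, hx c h1 h2 h3, hy c h1 h2 h3]
  smul_mem' := by
    intro r x hx c h1 h2 h3
    rw [smul_smul, ← Subring.mem_center_iff.1 h1 r, ← smul_smul, hx c h1 h2 h3]

/-- The multiplication map `A e ⊗_{eAe} e A → A e A` is bijective.  It is always onto; `A e ⊗ₖ e A`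
is regarded as a subspace of `A ⊗ₖ A`, and injectivity says that an element of it with
product zero is a combination of the relations `x c ⊗ y = x ⊗ c y` with `x ∈ A e`,
`c ∈ e A e`, `y ∈ e A`. -/
def MultiplicationBijective (k : Type w) [Field k] {A : Type u} [Ring A] [Algebra k A]
    (e : A) : Prop :=
  ∀ z ∈ Submodule.span k {z : A ⊗[k] A | ∃ a b : A, z = (a * e) ⊗ₜ[k] (e * b)},
    LinearMap.mul' k A z = 0 →
    z ∈ Submodule.span k {z : A ⊗[k] A | ∃ a c b : A,
      z = (a * e * (e * c * e)) ⊗ₜ[k] (e * b) - (a * e) ⊗ₜ[k] (e * c * e * (e * b))}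

end OneAlgebra

/-! ### Towers -/

/-- A chain of algebras `A 0 ⊆ A 1 ⊆ ⋯` with idempotents such that `A n` is isomorphic to the
corner of `A (n + 2)`.  The idempotent `e n` of `A (n + 2)` is the usual `e_{n+2}`. -/
structure TowerData (k : Type w) [Field k] (A : ℕ → Type u) [∀ n, Ring (A n)]
    [∀ n, Algebra k (A n)] where
  /-- the idempotents -/
  e : ∀ n, A (n + 2)
  /-- the isomorphism of `A n` onto the corner, as a map to `A (n + 2)` -/
  Φ : ∀ n, A n →ₙₐ[k] A (n + 2)
  /-- the inclusion of `A n` in `A (n + 1)` -/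
  ι : ∀ n, A n →ₐ[k] A (n + 1)
  e_idem : ∀ n, IsIdempotentElem (e n)
  Φ_one : ∀ n, Φ n 1 = e n
  Φ_injective : ∀ n, Function.Injective (Φ n)
  Φ_corner : ∀ n (x : A (n + 2)), ∃ a, Φ n a = e n * x * e n
  ι_injective : ∀ n, Function.Injective (ι n)

namespace TowerData

variable {k : Type w} [Field k] {A : ℕ → Type u} [∀ n, Ring (A n)] [∀ n, Algebra k (A n)]
  (T : TowerData k A)

/-- The composite embedding of `A m` as a corner of `A (m + 2 t)`. -/
def embAt (m : ℕ) : ∀ t : ℕ, A m →ₙₐ[k] A (m + 2 * t)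
  | 0 => NonUnitalAlgHom.id k (A m)
  | t + 1 => (T.Φ (m + 2 * t)).comp (embAt m t)

/-- The idempotent `e_{n,t}` of `A n`, `n = m + 2 t`, given by `e_{n,0} = 1` and
`e_{n,t+1} = Φ (e_{n-2,t})`. -/
def idem (m t : ℕ) : A (m + 2 * t) := T.embAt m t 1

/-- The same embedding with target `A n`; it is zero unless `n` is one of `m`, `m + 2`, .... -/
def emb (m n : ℕ) : A m →ₙₐ[k] A n :=
  if h : m + 2 * ((n - m) / 2) = n then h ▸ T.embAt m ((n - m) / 2) else 0

/-- The simple `A m`-module is killed by the idempotent, that is, it is a module for the quotient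
of `A m` by the ideal generated by that idempotent (no condition for `m = 0, 1`). -/
def IsTop : (m : ℕ) → SimpleClass (A m) → Prop
  | 0, _ => True
  | 1, _ => True
  | j + 2, c => ∀ x : c.Rep, T.e j • x = 0

/-- Weights: the disjoint union over `m` of the sets `Λ^m` of classes of simple modules of `A m`
modulo the ideal generated by its idempotent. -/
structure Weight where
  /-- the number `m` with `lam ∈ Λ^m` -/
  deg : ℕ
  /-- the simple `A m`-module -/
  cls : SimpleClass (A deg)
  top : T.IsTop deg cls

/-- The set `Λ_n = Λ^n ⊔ Λ^{n-2} ⊔ ⋯` of labels of the simple `A n`-modules. -/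
def Lam (n : ℕ) : Set T.Weight := {lam | ∃ t, lam.deg + 2 * t = n}

variable {T}

/-- The standard module `Δ_n(lam) = A_n e_{n,t} ⊗_{A_m} L`, where `lam ∈ Λ^m` is the class of
`L` and `n = m + 2 t`.  It is zero if `lam ∉ Λ_n`. -/
abbrev Weight.Delta (lam : T.Weight) (n : ℕ) : Type u := Extend (T.emb lam.deg n) lam.cls.Rep

/-- The simple module `L_n(lam)`, the head of `Δ_n(lam)`.  It is zero if `lam ∉ Λ_n`. -/
abbrev Weight.L (lam : T.Weight) (n : ℕ) : Type u :=
  lam.Delta n ⧸ Module.jacobson (A n) (lam.Delta n)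

/-- `P` is (isomorphic to) `P_n(lam)`, the projective cover of `L_n(lam)`; here `lam ∈ Λ_n`. -/
def Weight.IsP (lam : T.Weight) (n : ℕ) (P : Type v) [AddCommGroup P] [Module (A n) P] : Prop :=
  lam ∈ T.Lam n ∧ IsProjectiveCover (A n) P (lam.L n)

/-- The block `B_n(lam)`. -/
def Weight.blockAt (lam : T.Weight) (n : ℕ) : Set T.Weight :=
  {mu | lam ∈ T.Lam n ∧ mu ∈ T.Lam n ∧ SameBlock (A n) (lam.L n) (mu.L n)}

/-- The limit block `B(lam)`, the union of the `B_n(lam)`. -/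
def Weight.block (lam : T.Weight) : Set T.Weight := {mu | ∃ n, mu ∈ lam.blockAt n}

/-- The crude order on weights. -/
def Weight.Lt (lam mu : T.Weight) : Prop := ∃ n, lam ∈ T.Lam n ∧ mu ∉ T.Lam n

variable (T)

/-- `M` has a finite filtration whose subquotients are the standard modules `Δ_n(mu)`,
with `mu ∈ Λ_n` running through the multiset `s`. -/
def HasDeltaFiltration (n : ℕ) (M : Type v) [AddCommGroup M] [Module (A n) M]
    (s : Multiset T.Weight) : Prop :=
  ∃ l : List T.Weight, (l : Multiset T.Weight) = s ∧ (∀ mu ∈ l, mu ∈ T.Lam n) ∧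
    ∃ F : ℕ → Submodule (A n) M, Monotone F ∧ F 0 = ⊥ ∧ F l.length = ⊤ ∧
      ∀ (i : ℕ) (hi : i < l.length),
        Nonempty ((F (i + 1) ⧸ (F i).submoduleOf (F (i + 1))) ≃ₗ[A n] (l[i]).Delta n)

variable {T}

/-- `s` is the multiset `supp_{n+1}(lam)` of labels of the standard modules in a
filtration of the restriction of `Δ_{n+1}(lam)` to `A n`. -/
def Weight.IsSuppAt (lam : T.Weight) (n : ℕ) (s : Multiset T.Weight) : Prop :=
  T.HasDeltaFiltration n (Res (T.ι n) (lam.Delta (n + 1))) s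

/-- `s` is the multiset `supp(lam)`: every `supp_n(lam)` embeds in it, with
equality as soon as `lam ∈ Λ_{n-2}`. -/
def Weight.IsSupp (lam : T.Weight) (s : Multiset T.Weight) : Prop :=
  (∀ n, lam ∈ T.Lam (n + 1) → ∃ s' ≤ s, lam.IsSuppAt n s') ∧
    ∀ n, lam ∈ T.Lam n → lam.IsSuppAt (n + 1) s

open Classical in
/-- `B ∩ supp(lam) = t`, as multisets. -/
def Weight.SuppInter (lam : T.Weight) (B : Set T.Weight) (t : Multiset T.Weight) : Prop :=
  ∃ s, lam.IsSupp s ∧ s.filter (fun mu => mu ∈ B) = t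

/-- `lam'` separates `lamM` and `lamP` (that is, `λ⁻ < λ⁺`). -/
def Separates (lam' lamM lamP : T.Weight) : Prop :=
  lamM.Lt lamP ∧ lamM.SuppInter lam'.block {lam'} ∧ lamP.SuppInter lam'.block {lam'} ∧
    lam'.SuppInter lamM.block {lamP, lamM}

/-- `lam'` is in the lower closure of `lamP`; for `τ' = lam'` the weight `τ⁺` is `lamP`. -/
def InLowerClosure (lam' lamP : T.Weight) : Prop :=
  lam'.Lt lamP ∧ ∀ tau' ∈ lam'.block,
    (∃ tauP, tau'.SuppInter lamP.block {tauP} ∧ tauP.SuppInter lam'.block {tau'} ∧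
      (tau' = lam' → tauP = lamP)) ∨
    (∃ tauM ∈ lamP.block, ∃ tauP ∈ lamP.block, Separates tau' tauM tauP ∧
      (tau' = lam' → tauP = lamP))

/-- `B(lamP)` has enough local homomorphisms with respect to `B(lam')`: if `μ' ∈ B(lam')` separates
`μ⁻, μ⁺ ∈ B(lamP)`, then there is a nonzero map `Δ_n(μ⁺) → Δ_n(μ⁻)`.  (Whether
there is one does not depend on `n` as long as both weights lie in `Λ_n`.) -/
def EnoughLocalHoms (lamP lam' : T.Weight) : Prop :=
  ∀ muM ∈ lamP.block, ∀ muP ∈ lamP.block, ∀ mu' ∈ lam'.block, Separates mu' muM muP →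
    ∃ n, muM ∈ T.Lam n ∧ muP ∈ T.Lam n ∧ ∃ f : muP.Delta n →ₗ[A n] muM.Delta n, f ≠ 0

variable (T)

/-- The induced module `ind_n M = A_{n+1} ⊗_{A_n} M`. -/
abbrev Ind (n : ℕ) (M : Type v) [AddCommGroup M] [Module k M] [Module (A n) M] :
    Type (max u v) :=
  Extend (T.ι n : A n →ₙₐ[k] A (n + 1)) M

variable {T}

/-- The translation functor `ind_n^lam = pr_{n+1}^lam ind_n`. -/
noncomputable abbrev Weight.indTr (lam : T.Weight) (n : ℕ) (M : Type v) [AddCommGroup M] [Module k M]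
    [Module (A n) M] : Submodule (A (n + 1)) (T.Ind n M) :=
  blockPart (A (n + 1)) (lam.L (n + 1)) (T.Ind n M)

/-- The translation functor `res_{n+1}^lam = pr_n^lam res_{n+1}`. -/
noncomputable abbrev Weight.resTr (lam : T.Weight) (n : ℕ) (M : Type v) [AddCommGroup M]
    [Module (A (n + 1)) M] : Submodule (A n) (Res (T.ι n) M) :=
  blockPart (A n) (lam.L n) (Res (T.ι n) M)

variable (T)

/-- The axioms of a tower of recollement that are not already built into `TowerData`. -/
structure IsTowerOfRecollement : Prop where
  finite : ∀ n, Module.Finite k (A n)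
  /-- `A_0`, `A_1` and the quotients of `A_n` by the ideal generated by `e_n` are semisimple. -/
  semisimple_zero : IsSemisimpleRing (A 0)
  semisimple_one : IsSemisimpleRing (A 1)
  semisimple_quot : ∀ n, IsSemisimpleRing (TwoSidedIdeal.span {T.e n}).ringCon.Quotient
  /-- `A_n e_{n,t} ⊗ e_{n,t} A_n → A_n e_{n,t} A_n` is bijective. -/
  mult_bijective : ∀ m t, MultiplicationBijective k (T.idem m t)
  /-- `A_n e_n ≅ A_{n-1}` as a left `A_{n-1}`-, right `A_{n-2}`-bimodule. -/
  bimodule : ∀ n, ∃ f : A (n + 1) →ₗ[k] A (n + 2), Function.Injective f ∧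
    (∀ x, x ∈ Set.range f ↔ x * T.e n = x) ∧
    (∀ a b, f (a * b) = T.ι (n + 1) a * f b) ∧
    (∀ b c, f (b * T.ι n c) = f b * T.Φ n c)
  /-- For `lam ∈ Λ^m`, restricted standard modules have a filtration by standard modules
  with labels in `Λ^{m-1} ⊔ Λ^{m+1}`. -/
  res_delta : ∀ n, ∀ lam ∈ T.Lam (n + 1), ∃ s, lam.IsSuppAt n s ∧
    ∀ mu ∈ s, mu.deg + 1 = lam.deg ∨ mu.deg = lam.deg + 1
  /-- For `n ≥ 1` every `lam ∈ Λ^n` occurs in `supp_{n+1}(mu)` for some `mu ∈ Λ^{n-1}`. -/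
  res_supp : ∀ lam : T.Weight, 1 ≤ lam.deg → ∃ mu : T.Weight, mu.deg + 1 = lam.deg ∧
    ∃ s, mu.IsSuppAt lam.deg s ∧ lam ∈ s

end TowerData

end Recollement

/-! A projective cover `P_n(λ')` has the form `A_n f` for an idempotent `f`, and such an `f` is
recognised by its action on simple modules: it is nonzero only on copies of `L_n(λ')`, and its image
there is a line over `k` (Schur's lemma, with `k` algebraically closed). Induction replaces `f` by
`ι f`, and projection to a block multiplies by the central idempotent `c` of that block. So it
suffices that `c * ι f` is recognised in the same way by `L_{n+1}(λ⁺)` (`IsIdemFor.translate`). For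
restriction, `λ' ∈ Λ_n` allows the idempotent of `A_{n+2}` to be chosen as `Φ f`. Axiom (A4) then
identifies the restriction of `A_{n+2} Φ(f)` with `A_{n+1} ι(f)`, and the same idempotent settles
both claims.

The element `ι f` acts on a simple module `N = L_{n+1}(τ)` through its restriction, and only through
the block of `λ'`. The core is therefore `exists_simple_le_of_fixed`: for `τ ∈ B(λ⁺)` the
`B(λ')`-part of `res N` is zero or simple, and it is `L_n(λ')` only if `τ = λ⁺`. Choose a simple
submodule `V = L_n(τ')` of that part. By (A4), maps `Δ_n(τ') → res N` correspond to maps `res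
Δ_{n+2}(τ') → N`. Hence `τ` lies in `supp(τ')`, which leaves `τ = τ⁺` or, in the separated case, `τ
= τ⁻`.

The weight `τ⁻` is excluded by the local homomorphism `g : Δ(τ⁺) → Δ(τ⁻)`. Its image lies in the
kernel of `Δ(τ⁻) → L(τ⁻)` and, after restriction, carries the factor `L_n(τ')`, because that factor
survives in `L(τ⁺)` (`IsUpper.labels_res`). Since `res Δ(τ⁻)` has at most one standard factor in
`B(λ')`, namely `Δ_n(τ')`, the kernel swallows the whole block part. So `τ = τ⁺`, and the same
multiplicity bound for `res Δ(τ⁺)` shows that `V` is the whole block part of `res N`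
(`HasDeltaFiltration.smul_mem`). -/

namespace Recollement

/-! ### Corner embeddings and extension of modules along them -/

section ChangeOfRings

variable {k : Type w} [Field k] {B A : Type u} [Ring B] [Algebra k B] [Ring A] [Algebra k A]

/-- `φ` is an isomorphism of `B` onto the corner `φ(1) A φ(1)`. -/
structure IsCorner (φ : B →ₙₐ[k] A) : Prop where
  injective : Function.Injective φ
  corner : ∀ x, ∃ b, φ b = φ 1 * x * φ 1

theorem map_one_mul (φ : B →ₙₐ[k] A) (b : B) : φ 1 * φ b = φ b := by
  rw [← map_mul, one_mul]

theorem map_mul_one (φ : B →ₙₐ[k] A) (b : B) : φ b * φ 1 = φ b := by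
  rw [← map_mul, mul_one]

theorem IsCorner.id : IsCorner (NonUnitalAlgHom.id k A) :=
  ⟨fun _ _ h => h, fun x => ⟨x, by simp⟩⟩

theorem IsCorner.comp {C : Type u} [Ring C] [Algebra k C] {ψ : A →ₙₐ[k] C} {φ : B →ₙₐ[k] A}
    (hψ : IsCorner ψ) (hφ : IsCorner φ) : IsCorner (ψ.comp φ) := by
  refine ⟨fun x y h => hφ.injective (hψ.injective h), fun x => ?_⟩
  obtain ⟨a, ha⟩ := hψ.corner x
  obtain ⟨b, hb⟩ := hφ.corner a
  refine ⟨b, ?_⟩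
  simp only [NonUnitalAlgHom.comp_apply, hb, map_mul, ha]
  simp only [← mul_assoc, map_mul_one]
  simp only [mul_assoc, map_one_mul]

/-- The compression `a ↦ φ⁻¹(φ(1) a φ(1))`; its right `B`-linearity lets it define maps out of `A
φ(1) ⊗_B M`. -/
theorem IsCorner.exists_retraction {φ : B →ₙₐ[k] A} (hφ : IsCorner φ) :
    ∃ β : A →+ B, β 1 = 1 ∧ ∀ a b, β (a * φ b) = β a * b := by
  choose β hβ using hφ.corner
  refine ⟨AddMonoidHom.mk' β fun a a' => hφ.injective ?_, hφ.injective ?_,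
    fun a b => hφ.injective ?_⟩
  · rw [map_add, hβ, hβ, hβ, mul_add, add_mul]
  · rw [AddMonoidHom.mk'_apply, hβ, mul_one, map_one_mul]
  · change φ (β (a * φ b)) = φ (β a * b)
    rw [map_mul, hβ, hβ, mul_assoc, mul_assoc, mul_assoc, mul_assoc, map_mul_one, map_one_mul]

namespace Extend

variable (φ : B →ₙₐ[k] A) {M : Type v} [AddCommGroup M] [Module k M] [Module B M]

/-- The class of `a ⊗ x`. -/
def mk (a : A) (x : M) : Extend φ M := Submodule.Quotient.mk (a ⊗ₜ[k] x)

theorem smul_mk (a a' : A) (x : M) : a • mk φ a' x = mk φ (a * a') x := by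
  rw [mk, mk, ← Submodule.Quotient.mk_smul, TensorProduct.smul_tmul', smul_eq_mul]

theorem mk_add (a : A) (x y : M) : mk φ a (x + y) = mk φ a x + mk φ a y := by
  rw [mk, TensorProduct.tmul_add]; rfl

theorem add_mk (a b : A) (x : M) : mk φ (a + b) x = mk φ a x + mk φ b x := by
  rw [mk, TensorProduct.add_tmul]; rfl

theorem mk_mul (a : A) (b : B) (x : M) : mk φ (a * φ b) x = mk φ a (b • x) := by
  refine (Submodule.Quotient.eq _).2 (Submodule.subset_span ⟨a, b, x, rfl⟩)

theorem mk_mul_one (a : A) (x : M) : mk φ (a * φ 1) x = mk φ a x := by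
  rw [mk_mul, one_smul]

theorem induction {p : Extend φ M → Prop} (h : ∀ a x, p (mk φ a x))
    (hadd : ∀ y z, p y → p z → p (y + z)) (y : Extend φ M) : p y := by
  induction y using Submodule.Quotient.induction_on with
  | _ z =>
    induction z using TensorProduct.induction_on with
    | zero =>
      have := h 0 0
      rwa [mk, TensorProduct.tmul_zero] at this
    | tmul a x => exact h a x
    | add y z hy hz => exact hadd _ _ hy hz

/-- The canonical map `x ↦ 1 ⊗ x`. -/
def of : M →+ Extend φ M where
  toFun := mk φ 1
  map_zero' := by rw [mk, TensorProduct.tmul_zero]; rfl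
  map_add' := mk_add φ 1

theorem mk_eq (a : A) (x : M) : mk φ a x = a • of φ x := by
  change _ = a • mk φ 1 x
  rw [smul_mk, mul_one]

theorem of_smul (b : B) (x : M) : of φ (b • x) = φ b • of φ x := by
  rw [← mk_eq]
  change mk φ 1 (b • x) = _
  rw [← mk_mul, one_mul]

theorem one_smul_of (x : M) : φ 1 • of φ x = of φ x := by
  rw [← of_smul, one_smul]

theorem span_range_of : Submodule.span A (Set.range (of φ : M → Extend φ M)) = ⊤ := by
  refine (Submodule.eq_top_iff').2 fun y => ?_
  induction y using induction φ with
  | h a x => rw [mk_eq]; exact Submodule.smul_mem _ _ (Submodule.subset_span ⟨x, rfl⟩)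
  | hadd y z hy hz => exact Submodule.add_mem _ hy hz

variable {φ} {N : Type*} [AddCommGroup N]

theorem hom_ext [Module A N] {f g : Extend φ M →ₗ[A] N} (h : ∀ x, f (of φ x) = g (of φ x)) :
    f = g := by
  refine LinearMap.ext_on (span_range_of φ) ?_
  rintro _ ⟨x, rfl⟩
  exact h x

theorem exists_of_eq (hφ : IsCorner φ) (y : Extend φ M) : ∃ x, of φ x = φ 1 • y := by
  induction y using induction φ with
  | h a x =>
    obtain ⟨b, hb⟩ := hφ.corner a
    refine ⟨b • x, ?_⟩
    rw [of_smul, hb, ← mk_eq, mk_mul_one, smul_mk]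
  | hadd y z hy hz =>
    obtain ⟨x, hx⟩ := hy
    obtain ⟨x', hx'⟩ := hz
    exact ⟨x + x', by rw [map_add, hx, hx', smul_add]⟩

variable [IsScalarTower k B M]

/-- The additive map out of `A φ(1) ⊗_B M` given by a balanced biadditive map. -/
def liftAdd (h : A →+ M →+ N) (hb : ∀ a b x, h (a * φ b) x = h a (b • x)) : Extend φ M →+ N :=
  QuotientAddGroup.lift (balancedRel φ M).toAddSubgroup
    (TensorProduct.liftAddHom h (by
      intro c a x
      -- Balancedness over `k` follows from balancedness over `B`: inserting `φ(1)` turns the scalar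
      -- into `φ(c • 1)`. So the target needs no `k`-structure.
      have h1 : h (c • a) x = h (c • a * φ 1) x := by rw [hb, one_smul]
      rw [h1, smul_mul_assoc, ← mul_smul_comm, ← map_smul, hb, smul_assoc, one_smul])) (by
    intro z hz
    -- The relations are an `A`-span while the map is only additive, so the induction must carry all
    -- left multiples.
    suffices H : ∀ a : A, TensorProduct.liftAddHom (R := k) h _ (a • z) = 0 by
      simpa using H 1
    replace hz : z ∈ balancedRel φ M := hz
    rw [balancedRel] at hz
    induction hz using Submodule.span_induction with
    | mem z hz =>
      obtain ⟨a, b, x, rfl⟩ := hz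
      intro a'
      rw [smul_sub, TensorProduct.smul_tmul', TensorProduct.smul_tmul', map_sub]
      simp only [TensorProduct.liftAddHom_tmul, smul_eq_mul]
      rw [← mul_assoc, hb, sub_self]
    | zero => intro a; rw [smul_zero, map_zero]
    | add x y _ _ hx hy => intro a; rw [smul_add, map_add, hx, hy, add_zero]
    | smul b x _ hx => intro a; rw [smul_smul, hx])

/-- The linear map out of `A φ(1) ⊗_B M` that extends a semilinear map on `M`. -/
def lift [Module A N] (g : M →+ N) (hg : ∀ b x, g (b • x) = φ b • g x) : Extend φ M →ₗ[A] N where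
  toFun := liftAdd (AddMonoidHom.mk' (fun a => (DistribSMul.toAddMonoidHom N a).comp g)
    (fun a b => by ext x; exact add_smul a b (g x)))
    (fun a b x => by change (a * φ b) • g x = a • g (b • x); rw [hg, mul_smul])
  map_add' := map_add _
  map_smul' := by
    intro a y
    induction y using induction φ with
    | h a' x => exact mul_smul _ _ _
    | hadd y z hy hz => rw [smul_add, map_add, hy, hz, ← smul_add, ← map_add]

theorem lift_of [Module A N] (g : M →+ N) (hg : ∀ b x, g (b • x) = φ b • g x) (x : M) :
    lift g hg (of φ x) = g x := one_smul _ _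

theorem of_injective (hφ : IsCorner φ) : Function.Injective (of φ : M → Extend φ M) := by
  obtain ⟨β, hone, hmul⟩ := hφ.exists_retraction
  let h : A →+ M →+ M := AddMonoidHom.mk' (fun a => DistribSMul.toAddMonoidHom M (β a))
    (fun a b => by ext x; change β (a + b) • x = β a • x + β b • x; rw [map_add, add_smul])
  have hb : ∀ a b x, h (a * φ b) x = h a (b • x) := by
    intro a b x
    change β (a * φ b) • x = β a • b • x
    rw [hmul, mul_smul]
  refine Function.LeftInverse.injective (g := liftAdd h hb) fun x => ?_
  change β 1 • x = x
  rw [hone, one_smul]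

end Extend

end ChangeOfRings


/-! ### Heads of extended simple modules, and corners of simple modules -/

section ChangeOfRings

variable {k : Type w} [Field k] {B A : Type u} [Ring B] [Algebra k B] [Ring A] [Algebra k A]

namespace Extend

variable {φ : B →ₙₐ[k] A} {M : Type v} [AddCommGroup M] [Module k M] [Module B M]
  [IsSimpleModule B M]

/-- The corner of `A φ(1) ⊗_B M` is `M`. A nonzero corner vector in `N` generates the simple module
`M`, which generates everything. -/
theorem one_smul_eq_zero_of_ne_top (hφ : IsCorner φ) {N : Submodule A (Extend φ M)} (hN : N ≠ ⊤)
    {y : Extend φ M} (hy : y ∈ N) : φ 1 • y = 0 := by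
  by_contra h0
  obtain ⟨x, hx⟩ := exists_of_eq hφ y
  have hx0 : x ≠ 0 := by
    rintro rfl
    exact h0 (by rw [← hx, map_zero])
  refine hN (top_le_iff.1 ?_)
  rw [← span_range_of φ, Submodule.span_le]
  rintro _ ⟨z, rfl⟩
  obtain ⟨b, rfl⟩ := IsSimpleModule.toSpanSingleton_surjective B hx0 z
  simp only [LinearMap.toSpanSingleton_apply, SetLike.mem_coe]
  rw [of_smul, hx]
  exact N.smul_mem _ (N.smul_mem _ hy)

variable [IsScalarTower k B M]

theorem exists_isCoatom (hφ : IsCorner φ) :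
    ∃ R : Submodule A (Extend φ M), IsCoatom R ∧ ∀ N : Submodule A (Extend φ M), N ≠ ⊤ → N ≤ R := by
  -- The largest submodule killed by `φ(1)`; it contains every proper submodule.
  let R : Submodule A (Extend φ M) :=
    { carrier := {y | ∀ a : A, φ 1 • a • y = 0}
      zero_mem' := fun a => by rw [smul_zero, smul_zero]
      add_mem' := fun {x y} hx hy a => by rw [smul_add, smul_add, hx, hy, add_zero]
      smul_mem' := fun b x hx a => by rw [smul_smul a b]; exact hx _ }
  have hle : ∀ N : Submodule A (Extend φ M), N ≠ ⊤ → N ≤ R := fun N hN y hy a =>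
    one_smul_eq_zero_of_ne_top hφ hN (N.smul_mem a hy)
  refine ⟨R, ⟨fun htop => ?_, fun N hN => ?_⟩, hle⟩
  · have := IsSimpleModule.nontrivial B M
    obtain ⟨x, hx⟩ := exists_ne (0 : M)
    refine hx (of_injective hφ ?_)
    have : of φ x ∈ R := htop ▸ Submodule.mem_top
    have := this 1
    rwa [one_smul, one_smul_of, ← map_zero (of φ)] at this
  · by_contra hne
    exact (hle N hne).not_gt hN

theorem isCoatom_jacobson (hφ : IsCorner φ) : IsCoatom (Module.jacobson A (Extend φ M)) := by
  obtain ⟨R, hR, hle⟩ := exists_isCoatom (M := M) hφ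
  convert hR
  refine le_antisymm (sInf_le hR) (le_sInf fun C hC => ?_)
  exact ((hC.le_iff_eq hR.1).1 (hle C hC.1)).le

theorem le_jacobson (hφ : IsCorner φ) {N : Submodule A (Extend φ M)} (hN : N ≠ ⊤) :
    N ≤ Module.jacobson A (Extend φ M) := by
  obtain ⟨R, hR, hle⟩ := exists_isCoatom (M := M) hφ
  exact (hle N hN).trans
    (((isCoatom_jacobson hφ).le_iff_eq hR.1).1 (hle _ (isCoatom_jacobson hφ).1)).le

end Extend

/-- The corner `φ(1) N` as a `B`-module. -/
def corner (φ : B →ₙₐ[k] A) (N : Type*) [AddCommGroup N] [Module A N] : AddSubgroup N where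
  carrier := {x | φ 1 • x = x}
  zero_mem' := smul_zero _
  add_mem' := fun {x y} hx hy => by
    change _ • (x + y) = _
    rw [smul_add, show φ 1 • x = x from hx, show φ 1 • y = y from hy]
  neg_mem' := fun {x} hx => by
    change _ • (-x) = _
    rw [smul_neg, show φ 1 • x = x from hx]

instance (φ : B →ₙₐ[k] A) (N : Type*) [AddCommGroup N] [Module A N] : Module B (corner φ N) where
  smul b x := ⟨φ b • x.1, by change φ 1 • φ b • x.1 = _; rw [smul_smul, map_one_mul]⟩
  one_smul x := Subtype.ext x.2
  mul_smul a b x := Subtype.ext (by change φ (a * b) • x.1 = φ a • φ b • x.1; rw [map_mul, mul_smul])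
  smul_zero b := Subtype.ext (smul_zero (φ b))
  smul_add b x y := Subtype.ext (smul_add (φ b) x.1 y.1)
  add_smul a b x := Subtype.ext (by
    change φ (a + b) • x.1 = φ a • x.1 + φ b • x.1; rw [map_add, add_smul])
  zero_smul x := Subtype.ext (by change φ 0 • x.1 = 0; rw [map_zero, zero_smul])

theorem corner_coe_smul {φ : B →ₙₐ[k] A} {N : Type*} [AddCommGroup N] [Module A N] (b : B)
    (x : corner φ N) : (↑(b • x) : N) = φ b • (x : N) := rfl

theorem corner_one_smul {φ : B →ₙₐ[k] A} {N : Type*} [AddCommGroup N] [Module A N]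
    (x : corner φ N) : φ 1 • (x : N) = x := x.2

theorem isSimpleModule_corner {φ : B →ₙₐ[k] A} (hφ : IsCorner φ) {N : Type*} [AddCommGroup N]
    [Module A N] [IsSimpleModule A N] (h : ∃ x : N, φ 1 • x ≠ 0) :
    IsSimpleModule B (corner φ N) := by
  rw [isSimpleModule_iff_toSpanSingleton_surjective]
  constructor
  · obtain ⟨x, hx⟩ := h
    refine ⟨⟨φ 1 • x, ?_⟩, 0, fun h => hx (congrArg Subtype.val h)⟩
    change φ 1 • φ 1 • x = _
    rw [smul_smul, map_one_mul]
  · intro x hx y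
    obtain ⟨a, ha⟩ := IsSimpleModule.toSpanSingleton_surjective A
      (fun h => hx (Subtype.ext h) : (x : N) ≠ 0) (y : N)
    obtain ⟨b, hb⟩ := hφ.corner a
    refine ⟨b, Subtype.ext ?_⟩
    rw [LinearMap.toSpanSingleton_apply] at ha ⊢
    rw [corner_coe_smul, hb, mul_smul, corner_one_smul, mul_smul, ha, corner_one_smul]

end ChangeOfRings

instance {R : Type u} [Ring R] (c : SimpleClass R) : IsSimpleModule R c.Rep :=
  isSimpleModule_iff_isCoatom.2 (Quotient.out (s := simpleSetoid R) c).2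

theorem SimpleClass.exists_rep {R : Type u} [Ring R] (L : Type v) [AddCommGroup L] [Module R L]
    [IsSimpleModule R L] : ∃ c : SimpleClass R, Nonempty (c.Rep ≃ₗ[R] L) := by
  obtain ⟨I, hI, ⟨f⟩⟩ := isSimpleModule_iff_quot_maximal.1 (inferInstance : IsSimpleModule R L)
  let J : {I : Submodule R R // IsCoatom I} := ⟨I, Ideal.isMaximal_def.1 hI⟩
  obtain ⟨g⟩ := Quotient.mk_out (s := simpleSetoid R) J
  exact ⟨Quotient.mk (simpleSetoid R) J, ⟨g.trans f.symm⟩⟩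

theorem SimpleClass.eq_of_equiv {R : Type u} [Ring R] {c d : SimpleClass R}
    (f : c.Rep ≃ₗ[R] d.Rep) : c = d := by
  rw [← Quotient.out_eq (s := simpleSetoid R) c, ← Quotient.out_eq (s := simpleSetoid R) d]
  exact Quotient.sound (s := simpleSetoid R) ⟨f⟩

/-! ### Labelling of simple modules by weights -/

namespace TowerData

variable {k : Type w} [Field k] {A : ℕ → Type u} [∀ n, Ring (A n)] [∀ n, Algebra k (A n)]
  {T : TowerData k A}

theorem emb_add (m t : ℕ) : T.emb m (m + 2 * t) = T.embAt m t := by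
  have key : ∀ s (h : m + 2 * s = m + 2 * t), s = t → h ▸ T.embAt m s = T.embAt m t := by
    rintro s h rfl
    rfl
  unfold emb
  rw [dif_pos (by omega)]
  exact key _ _ (by omega)

theorem emb_self (m : ℕ) : T.emb m m = NonUnitalAlgHom.id k (A m) := T.emb_add m 0

theorem emb_add_two {tau : T.Weight} {n : ℕ} (h : tau ∈ T.Lam n) :
    T.emb tau.deg (n + 2) = (T.Φ n).comp (T.emb tau.deg n) := by
  obtain ⟨t, rfl⟩ := h
  rw [emb_add]
  exact T.emb_add tau.deg (t + 1)

theorem isCorner_Φ (n : ℕ) : IsCorner (T.Φ n) :=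
  ⟨T.Φ_injective n, fun x => by rw [T.Φ_one]; exact T.Φ_corner n x⟩

theorem isCorner_emb {tau : T.Weight} {n : ℕ} (h : tau ∈ T.Lam n) :
    IsCorner (T.emb tau.deg n) := by
  obtain ⟨t, rfl⟩ := h
  rw [emb_add]
  induction t with
  | zero => exact IsCorner.id
  | succ t ih => exact (T.isCorner_Φ _).comp ih

theorem deg_mem_Lam (tau : T.Weight) : tau ∈ T.Lam tau.deg := ⟨0, rfl⟩

theorem mem_Lam_add_two {tau : T.Weight} {n : ℕ} (h : tau ∈ T.Lam n) : tau ∈ T.Lam (n + 2) := by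
  obtain ⟨t, ht⟩ := h
  exact ⟨t + 1, by omega⟩

theorem mem_Lam_cases {tau : T.Weight} {n : ℕ} (h : tau ∈ T.Lam n) :
    tau.deg = n ∨ ∃ j, n = j + 2 ∧ tau ∈ T.Lam j := by
  obtain ⟨t, ht⟩ := h
  cases t with
  | zero => exact Or.inl ht
  | succ t => exact Or.inr ⟨tau.deg + 2 * t, by omega, t, rfl⟩

/-- `tau` labels the simple `A n`-module `L`, in the sense that there is a nonzero map from
`Δ_n(tau)` to `L`. -/
def Weight.Labels (tau : T.Weight) (n : ℕ) (L : Type v) [AddCommGroup L] [Module (A n) L] : Prop :=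
  tau ∈ T.Lam n ∧ ∃ j : tau.cls.Rep →+ L, j ≠ 0 ∧ ∀ b x, j (b • x) = T.emb tau.deg n b • j x

section Labels

variable {tau sig : T.Weight} {n : ℕ} {L : Type v} [AddCommGroup L] [Module (A n) L]

theorem isSimpleModule_L (h : tau ∈ T.Lam n) : IsSimpleModule (A n) (tau.L n) :=
  isSimpleModule_iff_isCoatom.2 (Extend.isCoatom_jacobson (isCorner_emb h))

theorem labels_of_ne_zero (h : tau ∈ T.Lam n) {f : tau.Delta n →ₗ[A n] L} (hf : f ≠ 0) :
    tau.Labels n L := by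
  refine ⟨h, f.toAddMonoidHom.comp (Extend.of (T.emb tau.deg n)), fun h0 => hf (Extend.hom_ext fun x => ?_),
    fun b x => ?_⟩
  · exact DFunLike.congr_fun h0 x
  · change f (Extend.of _ (b • x)) = _ • f (Extend.of _ x)
    rw [Extend.of_smul, map_smul]

theorem labels_L (h : tau ∈ T.Lam n) : tau.Labels n (tau.L n) := by
  refine labels_of_ne_zero h (f := Submodule.mkQ _) fun h0 => ?_
  refine (Extend.isCoatom_jacobson (M := tau.cls.Rep) (isCorner_emb h)).1 (top_le_iff.1 fun y _ => ?_)
  exact (Submodule.Quotient.mk_eq_zero _).1 (LinearMap.congr_fun h0 y)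

theorem Weight.Labels.exists_hom (h : tau.Labels n L) : ∃ f : tau.Delta n →ₗ[A n] L, f ≠ 0 := by
  obtain ⟨_, j, hj0, hj⟩ := h
  refine ⟨Extend.lift j hj, fun h0 => hj0 (AddMonoidHom.ext fun x => ?_)⟩
  rw [← Extend.lift_of j hj, h0]
  rfl

theorem Weight.Labels.exists_one_smul (h : tau.Labels n L) :
    ∃ x : L, x ≠ 0 ∧ T.emb tau.deg n 1 • x = x := by
  obtain ⟨_, j, hj0, hj⟩ := h
  obtain ⟨x, hx⟩ := DFunLike.ne_iff.1 hj0
  exact ⟨j x, hx, by rw [← hj, one_smul]⟩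

theorem Weight.Labels.map {L' : Type*} [AddCommGroup L'] [Module (A n) L'] (h : tau.Labels n L)
    (f : L →ₗ[A n] L') (hf : Function.Injective f) : tau.Labels n L' := by
  obtain ⟨hn, j, hj0, hj⟩ := h
  refine ⟨hn, f.toAddMonoidHom.comp j, fun h0 => hj0 (AddMonoidHom.ext fun x => hf ?_),
    fun b x => ?_⟩
  · exact (DFunLike.congr_fun h0 x).trans (map_zero f).symm
  · change f (j (b • x)) = _ • f (j x)
    rw [hj, map_smul]

/-- The standard module has only one maximal submodule, so the kernel of any map onto a simple
module is the radical. -/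
theorem Weight.Labels.equiv_L [IsSimpleModule (A n) L] (h : tau.Labels n L) :
    Nonempty (tau.L n ≃ₗ[A n] L) := by
  obtain ⟨f, hf⟩ := h.exists_hom
  have hs : Function.Surjective f := LinearMap.surjective_of_ne_zero hf
  have hk : Module.jacobson (A n) (tau.Delta n) = LinearMap.ker f := by
    have hc := LinearMap.isCoatom_ker_of_surjective hs
    have hc' := Extend.isCoatom_jacobson (M := tau.cls.Rep) (isCorner_emb h.1)
    exact (hc.le_iff_eq hc'.1).1 (Extend.le_jacobson (isCorner_emb h.1) hc.1)
  exact ⟨(Submodule.quotEquivOfEq _ _ hk).trans (f.quotKerEquivOfSurjective hs)⟩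

theorem Weight.Labels.of_corner {L : Type v} [AddCommGroup L] [Module (A (n + 2)) L]
    (h : tau.Labels n (corner (T.Φ n) L)) : tau.Labels (n + 2) L := by
  obtain ⟨hn, j, hj0, hj⟩ := h
  refine ⟨mem_Lam_add_two hn, (AddSubgroup.subtype _).comp j,
    fun h0 => hj0 (AddMonoidHom.ext fun x => Subtype.ext ?_), fun b x => ?_⟩
  · exact DFunLike.congr_fun h0 x
  · change ((j (b • x) : corner (T.Φ n) L) : L) = _
    rw [hj, emb_add_two hn]
    rfl

theorem Weight.Labels.corner {L : Type v} [AddCommGroup L] [Module (A (n + 2)) L]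
    (hn : tau ∈ T.Lam n) (h : tau.Labels (n + 2) L) : tau.Labels n (corner (T.Φ n) L) := by
  obtain ⟨_, j, hj0, hj⟩ := h
  rw [emb_add_two hn] at hj
  have hmem : ∀ x, T.Φ n 1 • j x = j x := by
    intro x
    have h1 := hj 1 x
    rw [one_smul, NonUnitalAlgHom.comp_apply] at h1
    rw [h1, smul_smul, map_one_mul]
  refine ⟨hn, AddMonoidHom.codRestrict j (Recollement.corner (T.Φ n) L) hmem, fun h0 => hj0 ?_,
    fun b x => ?_⟩
  · ext x
    exact congrArg Subtype.val (DFunLike.congr_fun h0 x)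
  · exact Subtype.ext (hj b x)

theorem Weight.Labels.equiv_rep {L : Type v} [AddCommGroup L] [Module (A tau.deg) L]
    [IsSimpleModule (A tau.deg) L] (h : tau.Labels tau.deg L) :
    Nonempty (tau.cls.Rep ≃ₗ[A tau.deg] L) := by
  obtain ⟨_, j, hj0, hj⟩ := h
  rw [emb_self] at hj
  let f : tau.cls.Rep →ₗ[A tau.deg] L := { j with map_smul' := hj }
  have hf : f ≠ 0 := fun h0 => hj0 (AddMonoidHom.ext fun x => LinearMap.congr_fun h0 x)
  exact ⟨LinearEquiv.ofBijective f (LinearMap.bijective_of_ne_zero hf)⟩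

theorem Weight.smul_e_eq_zero {j : ℕ} {L : Type v} [AddCommGroup L] [Module (A (j + 2)) L]
    [IsSimpleModule (A (j + 2)) L] (h : tau.Labels (j + 2) L) (hd : tau.deg = j + 2) (x : L) :
    T.e j • x = 0 := by
  obtain ⟨d, c, ht⟩ := tau
  simp only at hd
  subst hd
  obtain ⟨f⟩ := h.equiv_rep
  obtain ⟨y, rfl⟩ := f.surjective x
  rw [← map_smul, show T.e j • y = 0 from ht y, map_zero]

theorem Weight.Labels.not_mem {j : ℕ} {L : Type v} [AddCommGroup L] [Module (A (j + 2)) L]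
    [IsSimpleModule (A (j + 2)) L] (h : tau.Labels (j + 2) L) (hd : tau.deg = j + 2) :
    ¬ (sig ∈ T.Lam j ∧ sig.Labels (j + 2) L) := by
  rintro ⟨hj, hs⟩
  obtain ⟨x, hx0, -⟩ := (hs.corner hj).exists_one_smul
  refine hx0 (Subtype.ext ?_)
  rw [← corner_one_smul, T.Φ_one, smul_e_eq_zero h hd]
  rfl

theorem Weight.Labels.exists_e_smul {L : Type v} [AddCommGroup L] [Module (A (n + 2)) L]
    (hn : tau ∈ T.Lam n) (h : tau.Labels (n + 2) L) : ∃ x : L, T.Φ n 1 • x ≠ 0 := by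
  obtain ⟨x, hx0, -⟩ := (h.corner hn).exists_one_smul
  exact ⟨x, fun h0 => hx0 (Subtype.ext (by rw [← corner_one_smul, h0]; rfl))⟩

/-- Induction through corners: if `e` acts as nonzero, both labels descend to the simple module `eL`
two levels down; otherwise both have degree `n` and `L` itself is the class. -/
theorem Weight.Labels.unique [IsSimpleModule (A n) L] (h : tau.Labels n L) (h' : sig.Labels n L) :
    tau = sig := by
  induction n using Nat.strong_induction_on generalizing L with
  | _ n ih =>
    rcases mem_Lam_cases h.1 with hd | ⟨j, rfl, hj⟩
    · rcases mem_Lam_cases h'.1 with hd' | ⟨j, rfl, hj⟩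
      · obtain ⟨d, c, ht⟩ := tau
        obtain ⟨d', c', ht'⟩ := sig
        simp only at hd hd'
        subst hd
        subst hd'
        obtain ⟨f⟩ := h.equiv_rep
        obtain ⟨g⟩ := h'.equiv_rep
        obtain rfl : c = c' := SimpleClass.eq_of_equiv (f.trans g.symm)
        rfl
      · exact absurd ⟨hj, h'⟩ (h.not_mem hd)
    · rcases mem_Lam_cases h'.1 with hd' | ⟨i, hi, hi'⟩
      · exact absurd ⟨hj, h⟩ (h'.not_mem hd')
      · obtain rfl : j = i := by omega
        have := isSimpleModule_corner (T.isCorner_Φ j) (h.exists_e_smul hj)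
        exact ih j (by omega) (h.corner hj) (h'.corner hi')

theorem exists_labels (n : ℕ) (L : Type v) [AddCommGroup L] [Module (A n) L]
    [IsSimpleModule (A n) L] : ∃ tau : T.Weight, tau.Labels n L := by
  have base : ∀ (n : ℕ) (L : Type v) [AddCommGroup L] [Module (A n) L] [IsSimpleModule (A n) L],
      (∀ c : SimpleClass (A n), (c.Rep ≃ₗ[A n] L) → T.IsTop n c) →
      ∃ tau : T.Weight, tau.Labels n L := by
    intro n L _ _ _ h
    obtain ⟨c, ⟨f⟩⟩ := SimpleClass.exists_rep (R := A n) L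
    refine ⟨⟨n, c, h c f⟩, deg_mem_Lam _, f.toLinearMap.toAddMonoidHom, fun h0 => ?_, ?_⟩
    · have := IsSimpleModule.nontrivial (A n) c.Rep
      obtain ⟨x, hx⟩ := exists_ne (0 : c.Rep)
      exact hx (f.injective ((DFunLike.congr_fun h0 x).trans (map_zero f).symm))
    · intro b x
      simp only [emb_self]
      exact map_smul f b x
  induction n using Nat.strong_induction_on generalizing L with
  | _ n ih =>
    rcases n with _ | _ | j
    · exact base 0 L fun _ _ => trivial
    · exact base 1 L fun _ _ => trivial
    · by_cases h : ∃ x : L, T.Φ j 1 • x ≠ 0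
      · have := isSimpleModule_corner (T.isCorner_Φ j) h
        obtain ⟨tau, ht⟩ := ih j (by omega) (corner (T.Φ j) L)
        exact ⟨tau, ht.of_corner⟩
      · push Not at h
        refine base _ L fun c f x => f.injective ?_
        rw [map_smul, ← T.Φ_one, h, map_zero]

/-- A label of larger degree is killed by the deeper corner idempotents. This is what makes
extensions of `Δ_n(sig)` by `L` split. -/
theorem Weight.Labels.smul_eq_zero_of_deg_lt [IsSimpleModule (A n) L] (h : tau.Labels n L)
    (hs : sig ∈ T.Lam n) (hlt : sig.deg < tau.deg) (x : L) : T.emb sig.deg n 1 • x = 0 := by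
  induction n using Nat.strong_induction_on generalizing L with
  | _ n ih =>
    rcases mem_Lam_cases hs with hd' | ⟨j, rfl, hj'⟩
    · obtain ⟨t, ht⟩ := h.1
      omega
    · rw [emb_add_two hj', NonUnitalAlgHom.comp_apply, ← map_mul_one, mul_smul]
      rcases mem_Lam_cases h.1 with hd | ⟨i, hi, hi'⟩
      · rw [T.Φ_one, smul_e_eq_zero h hd, smul_zero]
      · obtain rfl : j = i := by omega
        have := isSimpleModule_corner (T.isCorner_Φ j) (h.exists_e_smul hi')
        have hmem : T.Φ j 1 • T.Φ j 1 • x = T.Φ j 1 • x := by rw [smul_smul, map_one_mul]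
        exact congrArg Subtype.val (ih j (by omega) (h.corner hi') hj' ⟨_, hmem⟩)

end Labels

end TowerData


/-! ### Central idempotents, blocks and a splitting criterion -/

section Blocks

variable {R : Type u} [Ring R] {c : R} {M : Type v} [AddCommGroup M] [Module R M]

/-- Multiplication by a central element. -/
def centralMap (hc : c ∈ Subring.center R) (M : Type v) [AddCommGroup M] [Module R M] :
    M →ₗ[R] M where
  toFun x := c • x
  map_add' := smul_add c
  map_smul' r x := by
    rw [RingHom.id_apply, smul_smul, smul_smul, Subring.mem_center_iff.1 hc r]

theorem smul_smul_central (hc : c ∈ Subring.center R) (r : R) (x : M) : c • r • x = r • c • x :=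
  (centralMap hc M).map_smul r x

theorem smul_smul_idem (hi : IsIdempotentElem c) (x : M) : c • c • x = c • x := by
  rw [smul_smul, hi.eq]

theorem actsAsOne_of_smul_eq [IsSimpleModule R M] (hc : c ∈ Subring.center R) {x : M} (hx0 : x ≠ 0)
    (hx : c • x = x) : ActsAsOne c M := by
  intro y
  obtain ⟨r, rfl⟩ := IsSimpleModule.toSpanSingleton_surjective R hx0 y
  rw [LinearMap.toSpanSingleton_apply, smul_smul_central hc, hx]

theorem smul_eq_zero_of_not_actsAsOne [IsSimpleModule R M] (hc : c ∈ Subring.center R)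
    (hi : IsIdempotentElem c) (h : ¬ ActsAsOne c M) (x : M) : c • x = 0 := by
  by_contra h0
  exact h (actsAsOne_of_smul_eq hc h0 (smul_smul_idem hi x))

theorem ActsAsOne.of_injective {N : Type*} [AddCommGroup N] [Module R N] (h : ActsAsOne c M)
    (f : N →ₗ[R] M) (hf : Function.Injective f) : ActsAsOne c N :=
  fun x => hf (by rw [map_smul, h])

theorem ActsAsOne.of_surjective {N : Type*} [AddCommGroup N] [Module R N] (h : ActsAsOne c M)
    (f : M →ₗ[R] N) (hf : Function.Surjective f) : ActsAsOne c N := by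
  intro y
  obtain ⟨x, rfl⟩ := hf y
  rw [← map_smul, h]

theorem one_sub_mem_center (hc : c ∈ Subring.center R) : 1 - c ∈ Subring.center R :=
  Subring.sub_mem _ (Subring.one_mem _) hc

theorem actsAsOne_one_sub (h : ∀ x : M, c • x = 0) : ActsAsOne (1 - c) M := fun x => by
  rw [sub_smul, one_smul, h, sub_zero]

theorem actsAsOne_one_sub_iff : ActsAsOne (1 - c) M ↔ ∀ x : M, c • x = 0 :=
  ⟨fun h x => by have := h x; rwa [sub_smul, one_smul, sub_eq_self] at this, actsAsOne_one_sub⟩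

/-- `c` is the primitive central idempotent of the block that contains the simple module `L`. -/
structure IsBlockIdem (c : R) (L : Type v) [AddCommGroup L] [Module R L] : Prop where
  mem_center : c ∈ Subring.center R
  idem : IsIdempotentElem c
  acts : ActsAsOne c L
  mul_eq : ∀ d ∈ Subring.center R, IsIdempotentElem d → ActsAsOne d L → d * c = c

/-- A minimal left ideal `Rc` among those generated by central idempotents acting as one on `L`:
replacing `c` by `d * c` cannot shrink it. -/
theorem exists_isBlockIdem [IsArtinianRing R] (L : Type v) [AddCommGroup L] [Module R L] :
    ∃ c : R, IsBlockIdem c L := by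
  obtain ⟨I, ⟨c, hc, hi, ha, rfl⟩, hmin⟩ := IsArtinian.set_has_minimal
    {I : Submodule R R | ∃ c : R, c ∈ Subring.center R ∧ IsIdempotentElem c ∧ ActsAsOne c L ∧
      I = Submodule.span R {c}} ⟨_, 1, Subring.one_mem _, IsIdempotentElem.one, one_smul R, rfl⟩
  refine ⟨c, hc, hi, ha, fun d hd hdi hda => ?_⟩
  have hcd : Commute d c := Subring.mem_center_iff.1 hc d
  have hle : Submodule.span R {d * c} ≤ Submodule.span R {c} := by
    rw [Submodule.span_singleton_le_iff_mem]
    exact Submodule.smul_mem _ d (Submodule.mem_span_singleton_self c)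
  have hmem : c ∈ Submodule.span R {d * c} := by
    by_contra hne
    refine hmin (Submodule.span R {d * c}) ⟨d * c, Subring.mul_mem _ hd hc,
      IsIdempotentElem.mul_of_commute hcd hdi hi, fun x => by rw [mul_smul, ha, hda], rfl⟩
      (lt_of_le_of_ne hle fun heq => hne ?_)
    rw [heq]
    exact Submodule.mem_span_singleton_self c
  obtain ⟨x, hx⟩ := Submodule.mem_span_singleton.1 hmem
  rw [← hx, smul_eq_mul, ← mul_assoc, ← Subring.mem_center_iff.1 hd x, mul_assoc x, ← mul_assoc d,
    hdi.eq]

theorem IsBlockIdem.mem_blockPart {L : Type w} [AddCommGroup L] [Module R L] (h : IsBlockIdem c L)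
    {x : M} : x ∈ blockPart R L M ↔ c • x = x := by
  refine ⟨fun hx => hx c h.mem_center h.idem h.acts, fun hx d hd hdi hda => ?_⟩
  rw [← hx, smul_smul, h.mul_eq d hd hdi hda]

theorem IsBlockIdem.sameBlock {L : Type w} [AddCommGroup L] [Module R L] [IsSimpleModule R L]
    [IsSimpleModule R M] (h : IsBlockIdem c L) (hM : ActsAsOne c M) : SameBlock R L M := by
  intro d hd hdi
  refine ⟨fun hda x => ?_, fun hda => ?_⟩
  · rw [← hM x, smul_smul, h.mul_eq d hd hdi hda]
  · by_contra hn
    have := IsSimpleModule.nontrivial R M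
    obtain ⟨x, hx⟩ := exists_ne (0 : M)
    have h1 := h.mul_eq (1 - d) (one_sub_mem_center hd) hdi.one_sub
      (actsAsOne_one_sub (smul_eq_zero_of_not_actsAsOne hd hdi hn))
    rw [sub_mul, one_mul, sub_eq_self] at h1
    refine hx ?_
    rw [← hda x, ← hM x, smul_smul, h1, zero_smul]

variable {k : Type w} [Field k] {B A : Type u} [Ring B] [Algebra k B] [Ring A] [Algebra k A]
  {φ : B →ₙₐ[k] A} {S : Type v} [AddCommGroup S] [Module k S] [Module B S]
  [IsScalarTower k B S]

/-- The image of `c` covers the head, hence is not inside the radical, hence is everything. Thus a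
standard module lies in the block of its head. -/
theorem Extend.actsAsOne [IsSimpleModule B S] (hφ : IsCorner φ) {c : A} (hc : c ∈ Subring.center A)
    (hi : IsIdempotentElem c)
    (h : ActsAsOne c (Extend φ S ⧸ Module.jacobson A (Extend φ S))) : ActsAsOne c (Extend φ S) := by
  have htop : LinearMap.range (centralMap hc (Extend φ S)) = ⊤ := by
    by_contra hne
    refine (isCoatom_jacobson (M := S) hφ).1 (top_le_iff.1 fun y _ => ?_)
    rw [← Submodule.Quotient.mk_eq_zero, ← h (Submodule.Quotient.mk y),
      ← Submodule.Quotient.mk_smul, Submodule.Quotient.mk_eq_zero]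
    exact le_jacobson hφ hne ⟨y, rfl⟩
  intro y
  obtain ⟨z, rfl⟩ : y ∈ LinearMap.range (centralMap hc (Extend φ S)) := htop ▸ Submodule.mem_top
  exact smul_smul_idem hi z

theorem Extend.smul_eq_zero [IsSimpleModule B S] (hφ : IsCorner φ) {c : A} (hc : c ∈ Subring.center A)
    (hi : IsIdempotentElem c)
    (h : ¬ ActsAsOne c (Extend φ S ⧸ Module.jacobson A (Extend φ S))) (y : Extend φ S) :
    c • y = 0 := by
  have : IsSimpleModule A (Extend φ S ⧸ Module.jacobson A (Extend φ S)) :=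
    isSimpleModule_iff_isCoatom.2 (isCoatom_jacobson hφ)
  exact actsAsOne_one_sub_iff.1 (actsAsOne hφ (one_sub_mem_center hc) hi.one_sub
    (actsAsOne_one_sub (smul_eq_zero_of_not_actsAsOne hc hi h))) y

/-- There are no nontrivial extensions of `A φ(1) ⊗_B S` by modules that `φ(1)` kills. -/
theorem Extend.exists_extension {Y N : Type*} [AddCommGroup Y] [Module A Y] [AddCommGroup N]
    [Module A N] (q : Y →ₗ[A] Extend φ S) (hq : Function.Surjective q)
    (h : LinearMap.ker q →ₗ[A] N) (hN : ∀ x : N, φ 1 • x = 0) :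
    ∃ h' : Y →ₗ[A] N, ∀ z : LinearMap.ker q, h' z = h z := by
  -- `(Y × N) ⧸ G` is the pushout of `Y` along `h`, an extension of `A φ(1) ⊗_B S` by `N`; a
  -- retraction onto `N` gives the desired map.
  let G : Submodule A (Y × N) := LinearMap.range ((LinearMap.ker q).subtype.prod (-h))
  let p : ((Y × N) ⧸ G) →ₗ[A] Extend φ S := G.liftQ (q ∘ₗ LinearMap.fst A Y N) (by
    rintro _ ⟨z, rfl⟩
    exact z.2)
  let inr : N →ₗ[A] ((Y × N) ⧸ G) := G.mkQ ∘ₗ LinearMap.inr A Y N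
  let inl : Y →ₗ[A] ((Y × N) ⧸ G) := G.mkQ ∘ₗ LinearMap.inl A Y N
  have pinl : ∀ y, p (inl y) = q y := fun y => rfl
  have hinj : Function.Injective inr := by
    refine (injective_iff_map_eq_zero inr).2 fun x hx => ?_
    obtain ⟨z, hz⟩ := (Submodule.Quotient.mk_eq_zero G).1 hx
    obtain ⟨hz1, hz2⟩ := Prod.ext_iff.1 hz
    have hz0 : z = 0 := Subtype.ext hz1
    rw [hz0, map_zero] at hz2
    exact hz2.symm
  have hker : ∀ w, p w = 0 → w ∈ LinearMap.range inr := by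
    intro w hw
    obtain ⟨⟨y, x⟩, rfl⟩ := G.mkQ_surjective w
    refine ⟨x + h ⟨y, hw⟩, ?_⟩
    refine (Submodule.Quotient.eq G).2 ⟨-⟨y, hw⟩, ?_⟩
    ext <;> simp
  -- As `φ(1)` kills `N`, corner vectors lift uniquely. Uniqueness makes the lifting of `S` additive
  -- and `B`-semilinear, so it extends to a section `J`.
  have huniq : ∀ w w', φ 1 • w = w → φ 1 • w' = w' → p w = p w' → w = w' := by
    intro w w' hw hw' hp
    obtain ⟨x, hx⟩ := hker (w - w') (by rw [map_sub, hp, sub_self])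
    rw [← sub_eq_zero, ← hw, ← hw', ← smul_sub, ← hx, ← map_smul, hN, map_zero]
  choose y hy using fun x : S => hq (of φ x)
  have hone : ∀ b w, φ 1 • (φ b • w : (Y × N) ⧸ G) = φ b • w := fun b w => by
    rw [smul_smul, map_one_mul]
  have hj : ∀ x, p (φ 1 • inl (y x)) = of φ x := fun x => by
    rw [map_smul, pinl, hy, one_smul_of]
  let j : S →+ ((Y × N) ⧸ G) := AddMonoidHom.mk' (fun x => φ 1 • inl (y x)) fun a b =>
    huniq _ _ (hone _ _) (by rw [← smul_add, hone]) (by rw [map_add, hj, hj, hj, map_add])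
  let J : Extend φ S →ₗ[A] ((Y × N) ⧸ G) := lift j fun b x =>
    huniq _ _ (hone _ _) (hone _ _) (by
      change p (φ 1 • inl (y (b • x))) = p (φ b • φ 1 • inl (y x))
      rw [hj, map_smul p (φ b), hj, of_smul])
  have hJ : ∀ z, p (J z) = z := by
    intro z
    exact LinearMap.congr_fun (hom_ext (f := p ∘ₗ J) (g := LinearMap.id) fun x => by
      change p (J (of φ x)) = of φ x
      rw [lift_of]
      exact hj x) z
  let r : ((Y × N) ⧸ G) →ₗ[A] N := (LinearEquiv.ofInjective inr hinj).symm.toLinearMap ∘ₗ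
    (LinearMap.id - J ∘ₗ p).codRestrict (LinearMap.range inr) fun w => hker _ (by
      change p (w - J (p w)) = 0
      rw [map_sub, hJ, sub_self])
  refine ⟨r ∘ₗ inl, fun z => hinj ?_⟩
  have h1 : inr (r (inl z)) = inl z - J (p (inl z)) :=
    congrArg Subtype.val ((LinearEquiv.ofInjective inr hinj).apply_symm_apply _)
  change inr (r (inl z)) = _
  rw [h1, pinl, show q z = 0 from z.2, map_zero, sub_zero]
  refine (Submodule.Quotient.eq G).2 ⟨z, ?_⟩
  ext <;> simp

end Blocks

/-! ### Modules with a filtration by standard modules -/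

namespace TowerData

variable {k : Type w} [Field k] {A : ℕ → Type u} [∀ n, Ring (A n)] [∀ n, Algebra k (A n)]
  {T : TowerData k A} {n : ℕ} {X : Type v} [AddCommGroup X] [Module (A n) X]
  {s : Multiset T.Weight}

theorem HasDeltaFiltration.mem_Lam (h : T.HasDeltaFiltration n X s) {sig : T.Weight}
    (hs : sig ∈ s) : sig ∈ T.Lam n := by
  obtain ⟨l, rfl, hl, -⟩ := h
  exact hl sig hs

theorem HasDeltaFiltration.induction (h : T.HasDeltaFiltration n X s)
    {p : Multiset T.Weight → Submodule (A n) X → Prop} (bot : p 0 ⊥)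
    (step : ∀ (t : Multiset T.Weight) (Z Y : Submodule (A n) X) (sig : T.Weight),
      sig ∈ T.Lam n → Z ≤ Y → ∀ q : Y →ₗ[A n] sig.Delta n, Function.Surjective q →
      (∀ y, q y = 0 ↔ (y : X) ∈ Z) → p t Z → p (sig ::ₘ t) Y) : p s ⊤ := by
  obtain ⟨l, rfl, hl, F, hF, h0, h1, hq⟩ := h
  suffices H : ∀ i ≤ l.length, p (l.take i : List T.Weight) (F i) by
    have := H l.length le_rfl
    rwa [List.take_length, h1] at this
  intro i
  induction i with
  | zero => intro _; rw [h0]; exact bot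
  | succ i ih =>
    intro hi
    obtain ⟨f⟩ := hq i hi
    have htake : ((l.take (i + 1) : List T.Weight) : Multiset T.Weight) =
        l[i] ::ₘ (l.take i : List T.Weight) := by
      rw [← List.take_append_getElem hi, ← Multiset.coe_add, add_comm]
      rfl
    rw [htake]
    refine step _ (F i) (F (i + 1)) _ (hl _ (List.getElem_mem hi)) (hF (Nat.le_succ i))
      (f.toLinearMap ∘ₗ Submodule.mkQ _) (f.surjective.comp (Submodule.mkQ_surjective _))
      (fun y => ?_) (ih (by omega))
    change f (Submodule.Quotient.mk y) = 0 ↔ _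
    rw [LinearEquiv.map_eq_zero_iff, Submodule.Quotient.mk_eq_zero]
    exact Iff.rfl

/-- At the first filtration step where `f` is nonzero, `f` factors through the standard quotient. -/
theorem HasDeltaFiltration.exists_labels (h : T.HasDeltaFiltration n X s) {N : Type*}
    [AddCommGroup N] [Module (A n) N] (f : X →ₗ[A n] N) (hf : f ≠ 0) :
    ∃ sig ∈ s, sig.Labels n N := by
  suffices H : (∃ x : X, x ∈ (⊤ : Submodule (A n) X) ∧ f x ≠ 0) → ∃ sig ∈ s, sig.Labels n N by
    obtain ⟨x, hx⟩ := DFunLike.ne_iff.1 hf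
    exact H ⟨x, Submodule.mem_top, hx⟩
  refine h.induction (p := fun s Y => (∃ x : X, x ∈ Y ∧ f x ≠ 0) → ∃ sig ∈ s, sig.Labels n N) ?_ ?_
  · rintro ⟨x, hx, hx'⟩
    exact absurd (by rw [(Submodule.mem_bot _).1 hx, map_zero]) hx'
  · rintro t Z Y sig hsig hZY q hq hqZ ih ⟨x, hx, hx'⟩
    by_cases hZ : ∃ z : X, z ∈ Z ∧ f z ≠ 0
    · obtain ⟨rho, hr, hr'⟩ := ih hZ
      exact ⟨rho, Multiset.mem_cons_of_mem hr, hr'⟩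
    · push Not at hZ
      refine ⟨sig, Multiset.mem_cons_self _ _, labels_of_ne_zero hsig
        (f := ((LinearMap.ker q).liftQ (f ∘ₗ Y.subtype) fun y hy => hZ y ((hqZ y).1 hy)) ∘ₗ
          (q.quotKerEquivOfSurjective hq).symm.toLinearMap) fun h0 => hx' ?_⟩
      have h1 := LinearMap.congr_fun h0 (q ⟨x, hx⟩)
      rw [LinearMap.comp_apply, LinearEquiv.coe_coe,
        show q ⟨x, hx⟩ = q.quotKerEquivOfSurjective hq (Submodule.Quotient.mk ⟨x, hx⟩) from rfl,
        LinearEquiv.symm_apply_apply] at h1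
      exact h1

-- With at most one standard factor `Δ_n(tau)` in the block, a submodule containing a block vector
-- visible to the idempotent of `tau` contains the whole block part: its image in `Δ_n(tau)` cannot
-- be proper, since the idempotent kills proper submodules. The induction also carries the case of
-- no factor, where `c` acts as zero.
open Classical in
theorem HasDeltaFiltration.smul_mem (h : T.HasDeltaFiltration n X s) {c : A n}
    (hc : c ∈ Subring.center (A n)) (hi : IsIdempotentElem c) {tau : T.Weight}
    {B : Set T.Weight} (hB : ∀ sig ∈ T.Lam n, ActsAsOne c (sig.L n) → sig ∈ B)
    (hs : s.filter (fun sig => sig ∈ B) ≤ {tau}) {N : Submodule (A n) X} {x : X}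
    (hx : x ∈ N) (hx0 : T.emb tau.deg n 1 • c • x ≠ 0) (y : X) : c • y ∈ N := by
  have H := h.induction (p := fun s Y =>
    (s.filter (fun sig => sig ∈ B) = 0 → ∀ y ∈ Y, c • y = 0) ∧
    (s.filter (fun sig => sig ∈ B) ≤ {tau} →
      ∀ x ∈ N, x ∈ Y → T.emb tau.deg n 1 • c • x ≠ 0 → ∀ y ∈ Y, c • y ∈ N)) ?_ ?_
  · exact H.2 hs x hx Submodule.mem_top hx0 y Submodule.mem_top
  · refine ⟨fun _ y hy => by rw [(Submodule.mem_bot _).1 hy, smul_zero], fun _ x _ _ _ y hy => ?_⟩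
    rw [(Submodule.mem_bot _).1 hy, smul_zero]
    exact N.zero_mem
  · rintro t Z Y sig hsig hZY q hq hqZ ⟨ih0, ih1⟩
    by_cases ha : sig ∈ B
    · rw [Multiset.filter_cons_of_pos _ ha]
      refine ⟨fun h0 => absurd h0 (Multiset.cons_ne_zero), fun hle x hx hxY hx0 y hy => ?_⟩
      obtain rfl : sig = tau :=
        Multiset.mem_singleton.1 (Multiset.mem_of_le hle (Multiset.mem_cons_self _ _))
      have ht0 : t.filter (fun sig => sig ∈ B) = 0 :=
        Multiset.le_zero.1 ((Multiset.cons_le_cons_iff sig).1 hle)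
      have htop : (N.submoduleOf Y).map q = ⊤ := by
        by_contra hne
        refine hx0 ?_
        have h1 := Extend.one_smul_eq_zero_of_ne_top (isCorner_emb hsig) hne
          (Submodule.mem_map_of_mem (f := q) (show c • (⟨x, hxY⟩ : Y) ∈ N.submoduleOf Y from
            N.smul_mem c hx))
        rw [← map_smul, hqZ] at h1
        have h2 := ih0 ht0 _ h1
        change c • T.emb sig.deg n 1 • c • x = 0 at h2
        rwa [smul_smul_central hc, smul_smul_idem hi] at h2
      obtain ⟨z, hz, hzy⟩ : q ⟨y, hy⟩ ∈ (N.submoduleOf Y).map q := htop ▸ Submodule.mem_top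
      have h1 : y - z ∈ Z := (hqZ (⟨y, hy⟩ - z)).1 (by rw [map_sub, hzy, sub_self])
      have h2 := ih0 ht0 _ h1
      rw [smul_sub, sub_eq_zero] at h2
      rw [h2]
      exact N.smul_mem c hz
    · rw [Multiset.filter_cons_of_neg _ ha]
      have hcY : ∀ y ∈ Y, c • y ∈ Z := fun y hy => (hqZ (c • ⟨y, hy⟩)).1 (by
        rw [map_smul]
        exact Extend.smul_eq_zero (isCorner_emb hsig) hc hi (fun h => ha (hB _ hsig h)) _)
      refine ⟨fun h0 y hy => ?_, fun hle x hx hxY hx0 y hy => ?_⟩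
      · rw [← smul_smul_idem hi]
        exact ih0 h0 _ (hcY y hy)
      · rw [← smul_smul_idem hi]
        exact ih1 hle (c • x) (N.smul_mem c hx) (hcY x hxY) (by rwa [smul_smul_idem hi]) _
          (hcY y hy)

/-- A map from the factor `Δ_n(tau)` onto `N` is extended up the filtration. Factors outside the
block are no obstacle after multiplication by `c`, and factors of smaller degree have only split
extensions by `N`. -/
theorem HasDeltaFiltration.exists_hom (h : T.HasDeltaFiltration n X s) {c : A n}
    (hc : c ∈ Subring.center (A n)) (hi : IsIdempotentElem c) {tau : T.Weight} (ht : tau ∈ s)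
    (hs : ∀ sig ∈ s, sig = tau ∨ ¬ ActsAsOne c (sig.L n) ∨ sig.deg < tau.deg) {N : Type*}
    [AddCommGroup N] [Module (A n) N] [IsSimpleModule (A n) N] (hN : tau.Labels n N)
    (hcN : ActsAsOne c N) : ∃ f : X →ₗ[A n] N, f ≠ 0 := by
  have H := h.induction (p := fun s Y => tau ∈ s →
    (∀ sig ∈ s, sig = tau ∨ ¬ ActsAsOne c (sig.L n) ∨ sig.deg < tau.deg) →
      ∃ f : Y →ₗ[A n] N, f ≠ 0) ?_ ?_ ht hs
  · obtain ⟨f, hf⟩ := H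
    refine ⟨f ∘ₗ Submodule.topEquiv.symm.toLinearMap, fun h0 => hf (LinearMap.ext fun y => ?_)⟩
    exact LinearMap.congr_fun h0 y
  · intro h0
    exact absurd h0 (Multiset.notMem_zero _)
  · intro t Z Y sig hsig hZY q hq hqZ ih hmem hs
    by_cases hst : sig = tau
    · subst hst
      obtain ⟨f, hf⟩ := hN.exists_hom
      refine ⟨f ∘ₗ q, fun h0 => hf (LinearMap.ext fun y => ?_)⟩
      obtain ⟨z, rfl⟩ := hq y
      exact LinearMap.congr_fun h0 z
    · obtain ⟨g, hg⟩ := ih ((Multiset.mem_cons.1 hmem).resolve_left (Ne.symm hst))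
        fun rho hr => hs rho (Multiset.mem_cons_of_mem hr)
      suffices H : ∃ f : Y →ₗ[A n] N, ∀ z : Z, f ⟨z, hZY z.2⟩ = g z by
        obtain ⟨f, hf⟩ := H
        refine ⟨f, fun h0 => hg (LinearMap.ext fun z => ?_)⟩
        rw [← hf, h0]
        rfl
      rcases (hs sig (Multiset.mem_cons_self _ _)).resolve_left hst with ha | hd
      · refine ⟨g ∘ₗ ((Y.subtype ∘ₗ centralMap hc Y).codRestrict Z fun y =>
          (hqZ (c • y)).1 (by
            rw [map_smul]
            exact Extend.smul_eq_zero (isCorner_emb hsig) hc hi ha _)), fun z => ?_⟩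
        rw [← hcN (g z), ← map_smul]
        rfl
      · obtain ⟨f, hf⟩ := Extend.exists_extension q hq
          (g ∘ₗ ((Y.subtype ∘ₗ (LinearMap.ker q).subtype).codRestrict Z fun y => (hqZ y).1 y.2))
          (hN.smul_eq_zero_of_deg_lt hsig hd)
        exact ⟨f, fun z => hf ⟨⟨z, hZY z.2⟩, (hqZ _).2 z.2⟩⟩

end TowerData


/-! ### Passage between `A_n` and `A_{n+2}`, and the adjunction from (A4) -/

section ChangeOfRings

variable {k : Type w} [Field k] {B A C : Type u} [Ring B] [Algebra k B] [Ring A] [Algebra k A]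
  [Ring C] [Algebra k C] {φ : B →ₙₐ[k] A} {θ : A →ₙₐ[k] C} {ψ : B →ₙₐ[k] C}
  {M : Type v} [AddCommGroup M] [Module k M] [Module B M] [IsScalarTower k B M]

/-- The map `A φ(1) ⊗_B M → C θ(φ(1)) ⊗_B M` given by `θ`. -/
def Extend.map (h : ψ = θ.comp φ) : Extend φ M →+ Extend ψ M :=
  liftAdd (AddMonoidHom.mk' (fun a => AddMonoidHom.mk' (fun x => mk ψ (θ a) x) (mk_add ψ _))
    (fun a a' => by ext x; change mk ψ (θ (a + a')) x = _; rw [map_add, add_mk]; rfl))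
    (fun a b x => by
      change mk ψ (θ (a * φ b)) x = mk ψ (θ a) (b • x)
      rw [← mk_mul, h, map_mul]; rfl)

theorem Extend.map_mk (h : ψ = θ.comp φ) (a : A) (x : M) :
    map h (mk φ a x) = mk ψ (θ a) x := rfl

theorem Extend.map_smul (h : ψ = θ.comp φ) (a : A) (y : Extend φ M) :
    map h (a • y) = θ a • map h y := by
  induction y using induction φ with
  | h a' x => rw [smul_mk, map_mk, map_mk, smul_mk, map_mul]
  | hadd y z hy hz => rw [smul_add, map_add, hy, hz, map_add, smul_add]

theorem Extend.map_injective (h : ψ = θ.comp φ) (hθ : IsCorner θ) :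
    Function.Injective (map (M := M) h) := by
  obtain ⟨β, hone, hmul⟩ := hθ.exists_retraction
  have hb : ∀ a, β (θ a) = a := fun a => by rw [← one_mul (θ a), hmul, hone, one_mul]
  let g : C →+ M →+ Extend φ M :=
    AddMonoidHom.mk' (fun a => AddMonoidHom.mk' (fun x => mk φ (β a) x) (mk_add φ _))
    (fun a a' => by ext x; change mk φ (β (a + a')) x = _; rw [map_add, add_mk]; rfl)
  have hg : ∀ a b x, g (a * ψ b) x = g a (b • x) := by
    intro a b x
    change mk φ (β (a * ψ b)) x = mk φ (β a) (b • x)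
    rw [h, NonUnitalAlgHom.comp_apply, hmul, mk_mul]
  refine Function.LeftInverse.injective (g := liftAdd g hg) fun y => ?_
  induction y using induction φ with
  | h a x =>
    change mk φ (β (θ a)) x = _
    rw [hb]
  | hadd y z hy hz => rw [map_add, map_add, hy, hz]

theorem Extend.exists_map_eq (h : ψ = θ.comp φ) (hθ : IsCorner θ) (z : Extend ψ M) :
    ∃ y : Extend φ M, map h y = θ 1 • z := by
  induction z using induction ψ with
  | h c x =>
    obtain ⟨a, ha⟩ := hθ.corner c
    refine ⟨mk φ (a * φ 1) x, ?_⟩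
    rw [map_mk, map_mul, ha, mul_assoc, map_one_mul, smul_mk, ← mk_mul_one ψ (θ 1 * c), h]
    rfl
  | hadd y z hy hz =>
    obtain ⟨y', hy⟩ := hy
    obtain ⟨z', hz⟩ := hz
    exact ⟨y' + z', by rw [map_add, hy, hz, smul_add]⟩

/-- Extending along `θ ∘ φ` and taking the corner along `θ` is extending along `φ`. -/
noncomputable def Extend.cornerEquiv (h : ψ = θ.comp φ) (hθ : IsCorner θ) :
    Extend φ M ≃ₗ[A] corner θ (Extend ψ M) :=
  LinearEquiv.ofBijective
    { toFun := fun y => ⟨map h y, by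
        obtain ⟨z, hz⟩ := exists_map_eq h hθ (map h y)
        change θ 1 • map h y = map h y
        rw [← map_smul, one_smul]⟩
      map_add' := fun y z => Subtype.ext (map_add (map h) y z)
      map_smul' := fun a y => Subtype.ext (map_smul h a y) }
    ⟨fun y z hyz => map_injective h hθ (congrArg Subtype.val hyz), fun z => by
      obtain ⟨y, hy⟩ := exists_map_eq h hθ (z : Extend ψ M)
      exact ⟨y, Subtype.ext (hy.trans (corner_one_smul z))⟩⟩

end ChangeOfRings

namespace TowerData

variable {k : Type w} [Field k] {A : ℕ → Type u} [∀ n, Ring (A n)] [∀ n, Algebra k (A n)]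
  {T : TowerData k A} {n : ℕ} {lam mu nu : T.Weight}

theorem labels_Delta_add_two (hl : lam ∈ T.Lam n) (hm : mu ∈ T.Lam n) :
    lam.Labels (n + 2) (mu.Delta (n + 2)) ↔ lam.Labels n (mu.Delta n) := by
  let E : mu.Delta n ≃ₗ[A n] corner (T.Φ n) (mu.Delta (n + 2)) :=
    Extend.cornerEquiv (M := mu.cls.Rep) (emb_add_two hm) (T.isCorner_Φ n)
  exact ⟨fun h => (h.corner hl).map E.symm.toLinearMap E.symm.injective,
    fun h => (h.map E.toLinearMap E.injective).of_corner⟩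

/-- Existence of a nonzero map between two standard modules does not depend on the level, because
`Δ_n` is the corner of `Δ_{n+2}`. -/
theorem labels_Delta_iff {m : ℕ} (hl : lam ∈ T.Lam n) (hm : mu ∈ T.Lam n) (hl' : lam ∈ T.Lam m)
    (hm' : mu ∈ T.Lam m) : lam.Labels m (mu.Delta m) ↔ lam.Labels n (mu.Delta n) := by
  have key : ∀ d, lam ∈ T.Lam d → mu ∈ T.Lam d → ∀ t,
      lam.Labels (d + 2 * t) (mu.Delta (d + 2 * t)) ↔ lam.Labels d (mu.Delta d) := by
    intro d hl hm t
    induction t with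
    | zero => exact Iff.rfl
    | succ t ih =>
      refine (labels_Delta_add_two (n := d + 2 * t) ?_ ?_).trans ih
      · obtain ⟨s, hs⟩ := hl
        exact ⟨s + t, by omega⟩
      · obtain ⟨s, hs⟩ := hm
        exact ⟨s + t, by omega⟩
  rcases le_total m n with hmn | hmn
  · obtain ⟨t, rfl⟩ : ∃ t, n = m + 2 * t := by
      obtain ⟨a, ha⟩ := hl
      obtain ⟨b, hb⟩ := hl'
      exact ⟨a - b, by omega⟩
    exact (key m hl' hm' t).symm
  · obtain ⟨t, rfl⟩ : ∃ t, m = n + 2 * t := by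
      obtain ⟨a, ha⟩ := hl
      obtain ⟨b, hb⟩ := hl'
      exact ⟨b - a, by omega⟩
    exact key n hl hm t

/-- Compress `c` to the corner. Consequently blocks can only grow from level `n` to level `n + 2`,
so that limit blocks are equivalence classes. -/
theorem exists_central_idem (c : A (n + 2)) (hc : c ∈ Subring.center (A (n + 2)))
    (hi : IsIdempotentElem c) : ∃ d ∈ Subring.center (A n), IsIdempotentElem d ∧
      ∀ tau ∈ T.Lam n, ActsAsOne c (tau.L (n + 2)) ↔ ActsAsOne d (tau.L n) := by
  obtain ⟨d, hd⟩ := (T.isCorner_Φ n).corner c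
  have hd' : T.Φ n d = c * T.Φ n 1 := by
    rw [hd, Subring.mem_center_iff.1 hc, mul_assoc, map_mul_one]
  have hcc : ∀ x, T.Φ n x * c = c * T.Φ n x :=
    fun x => Subring.mem_center_iff.1 hc _
  refine ⟨d, Subring.mem_center_iff.2 fun x => T.Φ_injective n ?_, T.Φ_injective n ?_, ?_⟩
  · rw [map_mul, map_mul, hd', ← mul_assoc, hcc, mul_assoc, mul_assoc, map_mul_one, map_one_mul]
  · rw [map_mul, hd', mul_assoc, ← mul_assoc _ c, hcc, ← mul_assoc, ← mul_assoc, hi.eq, mul_assoc,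
      map_mul_one]
  · intro tau ht
    have := isSimpleModule_L (mem_Lam_add_two ht)
    have := isSimpleModule_corner (T.isCorner_Φ n)
      ((labels_L (mem_Lam_add_two ht)).exists_e_smul ht)
    obtain ⟨f⟩ := ((labels_L (mem_Lam_add_two ht)).corner ht).equiv_L
    have hsm : ∀ x : corner (T.Φ n) (tau.L (n + 2)), (↑(d • x) : tau.L (n + 2)) = c • ↑x := by
      intro x
      rw [corner_coe_smul, hd', mul_smul, corner_one_smul]
    refine ⟨fun h => ?_, fun h => ?_⟩
    · exact ActsAsOne.of_injective (M := corner (T.Φ n) (tau.L (n + 2)))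
        (fun x => Subtype.ext ((hsm x).trans (h x))) f.toLinearMap f.injective
    · have h' := h.of_surjective f.toLinearMap f.surjective
      have := IsSimpleModule.nontrivial (A n) (corner (T.Φ n) (tau.L (n + 2)))
      obtain ⟨x, hx⟩ := exists_ne (0 : corner (T.Φ n) (tau.L (n + 2)))
      exact actsAsOne_of_smul_eq hc (fun h0 => hx (Subtype.ext h0) : (x : tau.L (n + 2)) ≠ 0)
        ((hsm x).symm.trans (congrArg Subtype.val (h' x)))

theorem mem_blockAt_add (h : mu ∈ lam.blockAt n) (t : ℕ) : mu ∈ lam.blockAt (n + 2 * t) := by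
  induction t with
  | zero => exact h
  | succ t ih =>
    obtain ⟨hl, hm, hs⟩ := ih
    refine ⟨mem_Lam_add_two hl, mem_Lam_add_two hm, fun c hc hi => ?_⟩
    obtain ⟨d, hd, hdi, hiff⟩ := T.exists_central_idem (n := n + 2 * t) c hc hi
    exact (hiff lam hl).trans ((hs d hd hdi).trans (hiff mu hm).symm)

theorem Weight.mem_block_symm (h : mu ∈ lam.block) : lam ∈ mu.block := by
  obtain ⟨n, hl, hm, hs⟩ := h
  exact ⟨n, hm, hl, fun c hc hi => (hs c hc hi).symm⟩

theorem Weight.mem_block_trans (h : mu ∈ lam.block) (h' : nu ∈ mu.block) : nu ∈ lam.block := by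
  obtain ⟨n, hn⟩ := h
  obtain ⟨m, hm⟩ := h'
  obtain ⟨a, ha⟩ := hn.2.1
  obtain ⟨b, hb⟩ := hm.1
  obtain ⟨hl, -, hs⟩ := mem_blockAt_add hn b
  obtain ⟨-, hv, hs'⟩ := mem_blockAt_add hm a
  have heq : m + 2 * a = n + 2 * b := by omega
  rw [heq] at hv hs'
  exact ⟨n + 2 * b, hl, hv, fun c hc hi => (hs c hc hi).trans (hs' c hc hi)⟩

theorem Weight.mem_block_of_actsAsOne {c : A n} (hc : IsBlockIdem c (lam.L n))
    (hl : lam ∈ T.Lam n) (hm : mu ∈ T.Lam n) (h : ActsAsOne c (mu.L n)) : mu ∈ lam.block := by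
  have := isSimpleModule_L hl
  have := isSimpleModule_L hm
  exact ⟨n, hl, hm, hc.sameBlock h⟩

/-- Axiom (A4) in coordinates: `u` is the image of `1`, and `A_{n+2} e` is free over `A_{n+1}` on
`u`, with coordinate `β b` for `b e`. -/
theorem IsTowerOfRecollement.exists_bimodule (hT : T.IsTowerOfRecollement) (n : ℕ) :
    ∃ (u : A (n + 2)) (β : A (n + 2) →+ A (n + 1)), β u = 1 ∧
      (∀ a b, β (T.ι (n + 1) a * b) = a * β b) ∧ (∀ b c, β (b * T.Φ n c) = β b * T.ι n c) ∧
      (∀ b, T.ι (n + 1) (β b) * u = b * T.e n) ∧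
      ∀ c, u * T.Φ n c = T.ι (n + 1) (T.ι n c) * u := by
  obtain ⟨f, hinj, hrange, hl, hr⟩ := hT.bimodule n
  have he : ∀ b, b * T.e n * T.e n = b * T.e n := fun b => by rw [mul_assoc, (T.e_idem n).eq]
  have hf : ∀ a, f a * T.e n = f a := fun a => (hrange _).1 ⟨a, rfl⟩
  choose β hβ using fun b => (hrange (b * T.e n)).2 (he b)
  have hu : ∀ a, f a = T.ι (n + 1) a * f 1 := fun a => by rw [← hl, mul_one]
  refine ⟨f 1, AddMonoidHom.mk' β fun a b => hinj ?_, hinj ?_, fun a b => hinj ?_,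
    fun b c => hinj ?_, fun b => ?_, fun c => ?_⟩
  · rw [map_add, hβ, hβ, hβ, add_mul]
  · rw [AddMonoidHom.mk'_apply, hβ, hf]
  · change f (β (T.ι (n + 1) a * b)) = f (a * β b)
    rw [hl, hβ, hβ, mul_assoc]
  · change f (β (b * T.Φ n c)) = f (β b * T.ι n c)
    rw [hr, hβ, hβ, mul_assoc, mul_assoc, ← T.Φ_one, map_mul_one, map_one_mul]
  · rw [AddMonoidHom.mk'_apply, ← hu, hβ]
  · rw [← hr, one_mul, hu]

/-- By (A4), `res Δ_{n+2}(lam)` is `ind Δ_n(lam)`, generated by the vectors `u ⊗ x`. This is one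
half of Frobenius reciprocity; the next lemma is the other. -/
theorem labels_res_of_ne_zero (hT : T.IsTowerOfRecollement) (hl : lam ∈ T.Lam n) {N : Type v}
    [AddCommGroup N] [Module (A (n + 1)) N]
    {F : Res (T.ι (n + 1)) (lam.Delta (n + 2)) →ₗ[A (n + 1)] N} (hF : F ≠ 0) :
    lam.Labels n (Res (T.ι n) N) := by
  obtain ⟨u, β, -, -, -, hu, hc⟩ := hT.exists_bimodule n
  have hemb : ∀ b, T.emb lam.deg (n + 2) b = T.Φ n (T.emb lam.deg n b) :=
    fun b => DFunLike.congr_fun (emb_add_two hl) b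
  let of' : lam.cls.Rep →+ lam.Delta (n + 2) := Extend.of (T.emb lam.deg (n + 2))
  let j : lam.cls.Rep →+ N := AddMonoidHom.mk' (fun x => F (show lam.Delta (n + 2) from u • of' x))
    fun x y => by rw [map_add, smul_add]; exact map_add F _ _
  refine ⟨hl, j, fun h0 => hF (LinearMap.ext fun y => ?_), fun b x => ?_⟩
  · change F y = 0
    induction y using Extend.induction (T.emb lam.deg (n + 2)) with
    | h a x =>
      have h1 : Extend.mk (T.emb lam.deg (n + 2)) a x =
          (β a • (show Res (T.ι (n + 1)) (lam.Delta (n + 2)) from u • of' x)) := by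
        change _ = T.ι (n + 1) (β a) • u • of' x
        rw [smul_smul, hu, mul_smul, Extend.mk_eq, ← T.Φ_one]
        change a • of' x = _
        rw [show T.Φ n 1 • of' x = of' x from ?_]
        have h2 := Extend.one_smul_of (T.emb lam.deg (n + 2)) x
        change _ • of' x = of' x at h2
        rw [← h2, hemb, smul_smul, map_one_mul]
      have h3 : F (u • of' x) = 0 := DFunLike.congr_fun h0 x
      exact (congrArg F h1).trans ((map_smul F _ _).trans (by rw [h3, smul_zero]))
    | hadd y z hy hz => exact (map_add F y z).trans ((congrArg₂ _ hy hz).trans (add_zero _))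
  · have h1 : u • of' (b • x) = T.ι (n + 1) (T.ι n (T.emb lam.deg n b)) • u • of' x := by
      rw [smul_smul, ← hc, mul_smul]
      refine congrArg (u • ·) ((Extend.of_smul _ _ _).trans ?_)
      rw [hemb]
    exact (congrArg F h1).trans (map_smul F _ _)

theorem exists_hom_of_labels_res (hT : T.IsTowerOfRecollement) {N : Type v}
    [AddCommGroup N] [Module (A (n + 1)) N] (h : lam.Labels n (Res (T.ι n) N)) :
    ∃ F : Res (T.ι (n + 1)) (lam.Delta (n + 2)) →ₗ[A (n + 1)] N, F ≠ 0 := by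
  obtain ⟨u, β, h1, h2, h3, -, -⟩ := hT.exists_bimodule n
  obtain ⟨hl, j, hj0, hj⟩ := h
  let j' : lam.cls.Rep →+ N := j
  have hj' : ∀ b x, j' (b • x) = T.ι n (T.emb lam.deg n b) • j' x := hj
  let g : A (n + 2) →+ lam.cls.Rep →+ N :=
    AddMonoidHom.mk' (fun a => (DistribSMul.toAddMonoidHom N (β a)).comp j')
    (fun a b => by
      ext x
      change β (a + b) • j' x = β a • j' x + β b • j' x
      rw [map_add, add_smul])
  let F : lam.Delta (n + 2) →+ N := Extend.liftAdd g (fun a b x => by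
    change β (a * T.emb lam.deg (n + 2) b) • j' x = β a • j' (b • x)
    rw [emb_add_two hl, NonUnitalAlgHom.comp_apply, h3, hj', mul_smul])
  refine ⟨{ toFun := F, map_add' := map_add F, map_smul' := fun a y => ?_ }, fun h0 => hj0 ?_⟩
  · change F (T.ι (n + 1) a • (show lam.Delta (n + 2) from y)) = a • F y
    induction y using Extend.induction (T.emb lam.deg (n + 2)) with
    | h b x =>
      rw [Extend.smul_mk]
      change β (T.ι (n + 1) a * b) • j' x = a • β b • j' x
      rw [h2, mul_smul]
    | hadd y z hy hz =>
      rw [smul_add, map_add, hy, hz, ← smul_add]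
      exact congrArg (a • ·) (map_add F y z).symm
  · ext x
    have := LinearMap.congr_fun h0 (Extend.mk (T.emb lam.deg (n + 2)) u x)
    change β u • j' x = 0 at this
    rw [h1, one_smul] at this
    exact this

end TowerData


/-! ### The block part of a restricted simple module -/

theorem exists_simple_of_ideal {R : Type u} [Ring R] {g : R} {I : Submodule R R} (hI : I ≠ ⊤)
    (hg : 1 - g ∈ I) : ∃ J : Submodule R R, I ≤ J ∧ IsSimpleModule R (R ⧸ J) ∧
      g • (Submodule.Quotient.mk 1 : R ⧸ J) = Submodule.Quotient.mk 1 ∧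
      (Submodule.Quotient.mk 1 : R ⧸ J) ≠ 0 := by
  obtain ⟨J, hJ, hle⟩ := Ideal.exists_le_maximal I hI
  refine ⟨J, hle, isSimpleModule_iff_isCoatom.2 (Ideal.isMaximal_def.1 hJ), ?_, fun h0 => ?_⟩
  · rw [← Submodule.Quotient.mk_smul, smul_eq_mul, mul_one, eq_comm, Submodule.Quotient.eq]
    exact hle hg
  · exact hJ.ne_top ((Ideal.eq_top_iff_one J).2 ((Submodule.Quotient.mk_eq_zero J).1 h0))

theorem exists_simple_smul_ne_zero {R : Type u} [Ring R] {g : R} (hg : IsIdempotentElem g)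
    (h0 : g ≠ 0) : ∃ J : Submodule R R, IsSimpleModule R (R ⧸ J) ∧ ∃ x : R ⧸ J, g • x ≠ 0 := by
  obtain ⟨J, -, hs, h1, h2⟩ := exists_simple_of_ideal (g := g)
    (I := LinearMap.ker (LinearMap.toSpanSingleton R R g)) (fun htop => h0 (by
      have : (1 : R) ∈ LinearMap.ker (LinearMap.toSpanSingleton R R g) := htop ▸ Submodule.mem_top
      rwa [LinearMap.mem_ker, LinearMap.toSpanSingleton_apply, one_smul] at this)) (by
      rw [LinearMap.mem_ker, LinearMap.toSpanSingleton_apply, smul_eq_mul, sub_mul, one_mul, hg.eq,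
        sub_self])
  exact ⟨J, hs, _, by rwa [h1]⟩

namespace TowerData

variable {k : Type w} [Field k] {A : ℕ → Type u} [∀ n, Ring (A n)] [∀ n, Algebra k (A n)]
  {T : TowerData k A} {n : ℕ} {lam' lamP tau tau' tauP : T.Weight}

theorem IsTowerOfRecollement.isArtinianRing (hT : T.IsTowerOfRecollement) (n : ℕ) :
    IsArtinianRing (A n) :=
  have := hT.finite n
  IsArtinianRing.of_finite k (A n)

/-- Restriction of linear maps along the inclusion of `A n` in `A (n + 1)`. -/
def resMap {M N : Type*} [AddCommGroup M] [AddCommGroup N] [Module (A (n + 1)) M]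
    [Module (A (n + 1)) N] (f : M →ₗ[A (n + 1)] N) :
    Res (T.ι n) M →ₗ[A n] Res (T.ι n) N where
  toFun := f
  map_add' := map_add f
  map_smul' a x := f.map_smul (T.ι n a) x

theorem Weight.Lt.ne {lam mu : T.Weight} (h : lam.Lt mu) : lam ≠ mu := by
  rintro rfl
  obtain ⟨n, h1, h2⟩ := h
  exact h2 h1

theorem Weight.Lt.deg_lt {lam mu : T.Weight} (h : lam.Lt mu) (hl : lam ∈ T.Lam n)
    (hm : mu ∈ T.Lam n) : lam.deg < mu.deg := by
  obtain ⟨m, ⟨a, ha⟩, h2⟩ := h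
  obtain ⟨b, hb⟩ := hl
  obtain ⟨c, hc⟩ := hm
  by_contra hle
  exact h2 ⟨a + c - b, by omega⟩

theorem Weight.Labels.exists_fixed {L : Type*} [AddCommGroup L] [Module (A n) L]
    (h : tau.Labels n L) {c : A n} (hc : c ∈ Subring.center (A n)) (hi : IsIdempotentElem c)
    (ha : ActsAsOne c (tau.L n)) : ∃ x : L, x ≠ 0 ∧ T.emb tau.deg n 1 • x = x ∧ c • x = x := by
  obtain ⟨f, hf⟩ := h.exists_hom
  obtain ⟨x, hx⟩ : ∃ x : tau.cls.Rep, f (Extend.of _ x) ≠ 0 := by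
    by_contra! h0
    exact hf (Extend.hom_ext h0)
  refine ⟨_, hx, ?_, ?_⟩
  · rw [← map_smul, Extend.one_smul_of]
  · rw [← map_smul, Extend.actsAsOne (S := tau.cls.Rep) (isCorner_emb h.1) hc hi ha]

/-- `tauP` is the weight `τ⁺` in `B(lamP)` attached to the weight `τ'` in `B(lam')`. -/
def IsUpper (lam' lamP tau' tauP : T.Weight) : Prop :=
  (tau'.SuppInter lamP.block {tauP} ∧ tauP.SuppInter lam'.block {tau'}) ∨
    ∃ tauM ∈ lamP.block, tauP ∈ lamP.block ∧ Separates tau' tauM tauP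

theorem InLowerClosure.exists_isUpper (h : InLowerClosure lam' lamP) (ht : tau' ∈ lam'.block) :
    ∃ tauP, IsUpper lam' lamP tau' tauP ∧ (tau' = lam' → tauP = lamP) := by
  rcases h.2 tau' ht with ⟨tauP, h1, h2, h3⟩ | ⟨tauM, h1, tauP, h2, h3, h4⟩
  · exact ⟨tauP, Or.inl ⟨h1, h2⟩, h3⟩
  · exact ⟨tauP, Or.inr ⟨tauM, h1, h2, h3⟩, h4⟩

theorem Weight.mem_block_self (lam : T.Weight) : lam ∈ lam.block :=
  ⟨lam.deg, deg_mem_Lam _, deg_mem_Lam _, fun _ _ _ => Iff.rfl⟩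

theorem Weight.SuppInter.exists_mem {B : Set T.Weight} {t : Multiset T.Weight}
    (h : tau.SuppInter B t) :
    ∃ s, tau.IsSupp s ∧ ∀ sig, sig ∈ t ↔ sig ∈ s ∧ sig ∈ B := by
  classical
  obtain ⟨s, hs, rfl⟩ := h
  exact ⟨s, hs, fun sig => Multiset.mem_filter⟩

/-- The labels in the support of `τ'` that lie in `B(lamP)`. -/
theorem IsUpper.exists_supp (h : IsUpper lam' lamP tau' tauP) :
    tauP ∈ lamP.block ∧ ∃ s, tau'.IsSupp s ∧ tauP ∈ s ∧ ∀ sig ∈ s, sig ∈ lamP.block →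
      sig = tauP ∨ sig ∈ lamP.block ∧ Separates tau' sig tauP := by
  rcases h with ⟨h1, -⟩ | ⟨tauM, hM, hP, hsep⟩
  · obtain ⟨s, hs, hmem⟩ := h1.exists_mem
    have h2 := (hmem tauP).1 (Multiset.mem_singleton_self _)
    exact ⟨h2.2, s, hs, h2.1, fun sig hsig hB =>
      Or.inl (Multiset.mem_singleton.1 ((hmem sig).2 ⟨hsig, hB⟩))⟩
  · obtain ⟨s, hs, hmem⟩ := hsep.2.2.2.exists_mem
    refine ⟨hP, s, hs, ((hmem tauP).1 (Multiset.mem_cons_self _ _)).1, fun sig hsig hB => ?_⟩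
    have h3 := (hmem sig).2 ⟨hsig, Weight.mem_block_trans (Weight.mem_block_symm hM) hB⟩
    rcases Multiset.mem_cons.1 h3 with rfl | h4
    · exact Or.inl rfl
    · obtain rfl := Multiset.mem_singleton.1 h4
      exact Or.inr ⟨hB, hsep⟩

theorem IsUpper.mem_Lam (h : IsUpper lam' lamP tau' tauP) (hl : tau' ∈ T.Lam n) :
    tauP ∈ T.Lam (n + 1) := by
  obtain ⟨-, s, hs, hP, -⟩ := h.exists_supp
  exact (hs.2 n hl).mem_Lam hP

/-- In `res Δ_{n+2}(τ')` the only factor of the block besides `Δ(τ⁺)` can be `Δ(τ⁻)`, of smaller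
degree, so `L(τ⁺)` is a quotient; reciprocity then applies. -/
theorem IsUpper.labels_res (hT : T.IsTowerOfRecollement) (h : IsUpper lam' lamP tau' tauP)
    (hl : tau' ∈ T.Lam n) {N : Type v} [AddCommGroup N] [Module (A (n + 1)) N]
    [IsSimpleModule (A (n + 1)) N] (hN : tauP.Labels (n + 1) N) :
    tau'.Labels n (Res (T.ι n) N) := by
  have := hT.isArtinianRing (n + 1)
  obtain ⟨hPB, s, hs, hP, hall⟩ := h.exists_supp
  have hfil : T.HasDeltaFiltration (n + 1) _ s := hs.2 n hl
  obtain ⟨c, hc⟩ := exists_isBlockIdem (R := A (n + 1)) (tauP.L (n + 1))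
  obtain ⟨f⟩ := hN.equiv_L
  obtain ⟨F, hF⟩ := hfil.exists_hom hc.mem_center hc.idem hP (fun sig hsig => by
    by_cases ha : ActsAsOne c (sig.L (n + 1))
    · have hB := Weight.mem_block_trans hPB
        (Weight.mem_block_of_actsAsOne hc (hfil.mem_Lam hP) (hfil.mem_Lam hsig) ha)
      rcases hall sig hsig hB with rfl | ⟨-, hsep⟩
      · exact Or.inl rfl
      · exact Or.inr (Or.inr (hsep.1.deg_lt (hfil.mem_Lam hsig) (hfil.mem_Lam hP)))
    · exact Or.inr (Or.inl ha)) hN (hc.acts.of_surjective f.toLinearMap f.surjective)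
  exact labels_res_of_ne_zero hT hl hF

theorem Weight.SuppInter.smul_mem {B : Set T.Weight} (h : tau.SuppInter B {tau'})
    (ht : tau ∈ T.Lam (n + 1)) {c : A n} (hc : c ∈ Subring.center (A n)) (hi : IsIdempotentElem c)
    (hB : ∀ sig ∈ T.Lam n, ActsAsOne c (sig.L n) → sig ∈ B)
    {N : Submodule (A n) (Res (T.ι n) (tau.Delta (n + 1)))}
    {x : Res (T.ι n) (tau.Delta (n + 1))} (hx : x ∈ N) (hx0 : T.emb tau'.deg n 1 • c • x ≠ 0)
    (y : Res (T.ι n) (tau.Delta (n + 1))) : c • y ∈ N := by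
  classical
  obtain ⟨s, hs, hst⟩ := h
  obtain ⟨s', hle, hfil⟩ := hs.1 n ht
  refine HasDeltaFiltration.smul_mem hfil hc hi hB ?_ hx hx0 y
  -- At level `n + 1` only a sub-multiset of the limit support is available, hence the bound `≤
  -- {τ'}` rather than equality.
  rw [← hst]
  exact Multiset.filter_le_filter _ hle

theorem smul_mem_of_labels {B : Set T.Weight} (h : tau.SuppInter B {tau'})
    {c : A n} (hc : c ∈ Subring.center (A n)) (hi : IsIdempotentElem c)
    (hB : ∀ sig ∈ T.Lam n, ActsAsOne c (sig.L n) → sig ∈ B) (hc' : ActsAsOne c (tau'.L n))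
    {N : Type v} [AddCommGroup N] [Module (A (n + 1)) N] [IsSimpleModule (A (n + 1)) N]
    (hN : tau.Labels (n + 1) N) {V : Submodule (A n) (Res (T.ι n) N)} (hV : tau'.Labels n V)
    (x : Res (T.ι n) N) : c • x ∈ V := by
  obtain ⟨f, hf⟩ := hN.exists_hom
  have hs : Function.Surjective f := LinearMap.surjective_of_ne_zero hf
  let F : Res (T.ι n) (tau.Delta (n + 1)) →ₗ[A n] Res (T.ι n) N := resMap f
  obtain ⟨v, hv0, hev, hcv⟩ := hV.exists_fixed hc hi hc'
  obtain ⟨y, hy⟩ : ∃ y, F y = v := hs (show N from (v : Res (T.ι n) N))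
  obtain ⟨z, rfl⟩ : ∃ z, F z = x := hs x
  rw [← map_smul]
  refine h.smul_mem hN.1 hc hi hB (N := V.comap F) (x := y) (by
    rw [Submodule.mem_comap, hy]; exact v.2) (fun h0 => hv0 ?_) z
  have h1 := congrArg F h0
  rw [map_smul, map_smul, map_zero, hy, ← Submodule.coe_smul, hcv, ← Submodule.coe_smul, hev] at h1
  exact Subtype.ext h1

/-- If `τ'` separates `τ⁻` and `τ⁺`, then `L_n(τ')` does not occur in the restriction of
`L_{n+1}(τ⁻)`. -/
theorem not_labels_of_separates (hT : T.IsTowerOfRecollement) (hU : IsUpper lam' lamP tau' tauP)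
    (h : tau.SuppInter lam'.block {tau'}) (hlt : tau.Lt tauP)
    (hhom : ∃ m, tau ∈ T.Lam m ∧ tauP ∈ T.Lam m ∧
      ∃ f : tauP.Delta m →ₗ[A m] tau.Delta m, f ≠ 0)
    {c : A n} (hc : c ∈ Subring.center (A n)) (hi : IsIdempotentElem c)
    (hB : ∀ sig ∈ T.Lam n, ActsAsOne c (sig.L n) → sig ∈ lam'.block)
    (hc' : ActsAsOne c (tau'.L n))
    {N : Type v} [AddCommGroup N] [Module (A (n + 1)) N] [IsSimpleModule (A (n + 1)) N]
    (hN : tau.Labels (n + 1) N) : ¬ tau'.Labels n (Res (T.ι n) N) := by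
  intro hV
  have hP := hU.mem_Lam hV.1
  have := isSimpleModule_L hP
  obtain ⟨f, hf⟩ := hN.exists_hom
  have hs : Function.Surjective f := LinearMap.surjective_of_ne_zero hf
  let F : Res (T.ι n) (tau.Delta (n + 1)) →ₗ[A n] Res (T.ι n) N := resMap f
  obtain ⟨v, hv0, hev, hcv⟩ := hV.exists_fixed hc hi hc'
  -- Otherwise `ker F` would contain the whole block part of `res Δ(τ⁻)`, leaving no room for `v` in
  -- the quotient.
  have hker : ∀ y, F y = 0 → T.emb tau'.deg n 1 • c • y = 0 := by
    intro y hy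
    by_contra hy0
    obtain ⟨z, hz⟩ : ∃ z, F z = v := hs v
    have h1 : F (c • z) = 0 := h.smul_mem hN.1 hc hi hB (N := LinearMap.ker F) hy hy0 z
    rw [map_smul, hz, hcv] at h1
    exact hv0 h1
  obtain ⟨m, hm, hm', g, hg⟩ := hhom
  obtain ⟨g, hg⟩ :=
    ((labels_Delta_iff hm' hm hP hN.1).2 (labels_of_ne_zero hm' hg)).exists_hom
  have hfg : f ∘ₗ g = 0 := by
    by_contra h0
    exact hlt.ne (hN.unique (labels_of_ne_zero hP h0))
  let G : Res (T.ι n) (tauP.Delta (n + 1)) →ₗ[A n] Res (T.ι n) (tau.Delta (n + 1)) := resMap g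
  obtain ⟨v', hv0', hev', hcv'⟩ := (hU.labels_res hT hV.1 (labels_L hP)).exists_fixed hc hi hc'
  let Q : Res (T.ι n) (tauP.Delta (n + 1)) →ₗ[A n] Res (T.ι n) (tauP.L (n + 1)) :=
    resMap (Submodule.mkQ _)
  obtain ⟨z, hz⟩ : ∃ z, Q z = v' := Submodule.mkQ_surjective _ v'
  have h1 : G (T.emb tau'.deg n 1 • c • z) = 0 := by
    rw [map_smul, map_smul]
    exact hker (G z) (LinearMap.congr_fun hfg z)
  -- The vector is killed by `g ≠ 0`, so it lies in the radical of `Δ(τ⁺)`; yet its image in `L(τ⁺)`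
  -- is `v'`.
  have h2 : Q (T.emb tau'.deg n 1 • c • z) = 0 :=
    (Submodule.Quotient.mk_eq_zero _).2
      (Extend.le_jacobson (M := tauP.cls.Rep) (isCorner_emb hP)
        (fun htop => hg (LinearMap.ker_eq_top.1 htop)) (show _ ∈ LinearMap.ker g from h1))
  rw [map_smul, map_smul, hz, hcv', hev'] at h2
  exact hv0' h2

/-- A simple submodule of the span of `v` lies in the block and already exhausts the block part; its
label determines `tau` as the upper weight. -/
theorem exists_simple_le_of_fixed (hT : T.IsTowerOfRecollement) (hloc : EnoughLocalHoms lamP lam')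
    (hlc : InLowerClosure lam' lamP) (hl : lam' ∈ T.Lam n) {c : A n} (hc : IsBlockIdem c (lam'.L n))
    (ht : tau ∈ lamP.block) {N : Type v} [AddCommGroup N] [Module (A (n + 1)) N]
    [IsSimpleModule (A (n + 1)) N] (hN : tau.Labels (n + 1) N) {v : Res (T.ι n) N} (hv0 : v ≠ 0)
    (hv : c • v = v) : ∃ V : Submodule (A n) (Res (T.ι n) N), IsSimpleModule (A n) V ∧
      (∀ x : Res (T.ι n) N, c • x ∈ V) ∧ (lam'.Labels n V → tau = lamP) := by
  have := hT.isArtinianRing n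
  have hnt : Nontrivial (Submodule.span (A n) {v}) :=
    ⟨⟨⟨v, Submodule.mem_span_singleton_self v⟩, 0, fun h => hv0 (congrArg Subtype.val h)⟩⟩
  obtain ⟨W, hW⟩ := IsAtomic.exists_atom (Submodule (A n) (Submodule.span (A n) {v}))
  have hWs : IsSimpleModule (A n) W := isSimpleModule_iff_isAtom.2 hW
  let E := Submodule.equivSubtypeMap (Submodule.span (A n) {v}) W
  have hVs : IsSimpleModule (A n) (W.map (Submodule.span (A n) {v}).subtype) :=
    IsSimpleModule.congr E.symm
  set V : Submodule (A n) (Res (T.ι n) N) := W.map (Submodule.span (A n) {v}).subtype with hVdef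
  have hVv : V ≤ Submodule.span (A n) {v} := Submodule.map_subtype_le _ _
  have hcV : ActsAsOne c V := by
    rintro ⟨x, hx⟩
    obtain ⟨a, rfl⟩ := Submodule.mem_span_singleton.1 (hVv hx)
    refine Subtype.ext ?_
    change c • a • v = a • v
    rw [smul_smul_central hc.mem_center, hv]
  obtain ⟨tau', hV⟩ := T.exists_labels n V
  obtain ⟨f⟩ := hV.equiv_L
  have hc' : ActsAsOne c (tau'.L n) := hcV.of_injective f.toLinearMap f.injective
  have := isSimpleModule_L hl
  have hB : ∀ sig ∈ T.Lam n, ActsAsOne c (sig.L n) → sig ∈ lam'.block := fun sig hs ha =>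
    Weight.mem_block_of_actsAsOne hc hl hs ha
  have htau' := hB tau' hV.1 hc'
  obtain ⟨tauP, hU, hP⟩ := hlc.exists_isUpper htau'
  have hVN : tau'.Labels n (Res (T.ι n) N) := hV.map V.subtype V.subtype_injective
  have hb : tau'.block = lam'.block := Set.ext fun x =>
    ⟨Weight.mem_block_trans htau', Weight.mem_block_trans (Weight.mem_block_symm htau')⟩
  have key : tau = tauP ∧ tau.SuppInter lam'.block {tau'} := by
    obtain ⟨hPB, s, hs, hmem, hall⟩ := hU.exists_supp
    obtain ⟨F, hF⟩ := exists_hom_of_labels_res hT hVN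
    -- Since `τ' ∈ Λ_n`, the support of `Δ_{n+2}(τ')` is the full limit support.
    have hfil : T.HasDeltaFiltration (n + 1) _ s := hs.2 n hV.1
    obtain ⟨sig, hsig, hsigN⟩ := hfil.exists_labels F hF
    obtain rfl := hN.unique hsigN
    have hne : ∀ hsep : Separates tau' tau tauP, False := by
      intro hsep
      have h1 : tau.SuppInter lam'.block {tau'} := hb ▸ hsep.2.1
      exact not_labels_of_separates hT hU h1 hsep.1 (hloc tau ht tauP hPB tau' htau' hsep)
        hc.mem_center hc.idem hB hc' hN hVN
    rcases hall tau hsig ht with rfl | ⟨-, hsep⟩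
    · refine ⟨rfl, ?_⟩
      rcases hU with ⟨-, h2⟩ | ⟨tauM, -, -, hsep⟩
      · exact h2
      · exact hb ▸ hsep.2.2.1
    · exact (hne hsep).elim
  refine ⟨V, hVs, fun x => smul_mem_of_labels key.2 hc.mem_center hc.idem hB hc' hN hV x, ?_⟩
  intro hl'
  exact key.1.trans (hP (hV.unique hl'))

/-! ### Translation of idempotents -/

/-- `f` is an idempotent of `A n` for which `A_n f` is the projective cover of `L_n(lam)`,
expressed by the action of `f` on the simple modules. -/
structure IsIdemFor (f : A n) (lam : T.Weight) : Prop where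
  idem : IsIdempotentElem f
  labels : ∀ (L : Type u) [AddCommGroup L] [Module (A n) L] [IsSimpleModule (A n) L],
    (∃ x : L, f • x ≠ 0) → lam.Labels n L
  fixed : ∀ (L : Type u) [AddCommGroup L] [Module (A n) L] [IsSimpleModule (A n) L],
    lam.Labels n L → ∃ x : L, x ≠ 0 ∧ f • x = x ∧
      ∀ y : L, f • y = y → ∃ a : k, y = algebraMap k (A n) a • x

/-- If `f (1 - c)` were nonzero, it would act as nonzero on some simple module; `f` forces that
module to be `L(λ')`, where `1 - c` vanishes. -/
theorem IsIdemFor.block_mul {f : A n} (hf : IsIdemFor f lam') {c : A n}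
    (hc : IsBlockIdem c (lam'.L n)) : c * f = f := by
  have hcomm : Commute f (1 - c) := Subring.mem_center_iff.1 (one_sub_mem_center hc.mem_center) f
  have h0 : f * (1 - c) = 0 := by
    by_contra hne
    obtain ⟨J, hJ, x, hx⟩ := exists_simple_smul_ne_zero
      (IsIdempotentElem.mul_of_commute hcomm hf.idem hc.idem.one_sub) hne
    rw [mul_smul] at hx
    obtain ⟨g⟩ := (hf.labels _ ⟨_, hx⟩).equiv_L
    have := (hc.acts.of_surjective g.toLinearMap g.surjective) x
    rw [sub_smul, one_smul, this, sub_self, smul_zero] at hx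
    exact hx rfl
  rw [hcomm.eq, sub_mul, one_mul, sub_eq_zero] at h0
  exact h0.symm

theorem IsIdemFor.translate (hT : T.IsTowerOfRecollement) (hloc : EnoughLocalHoms lamP lam')
    (hlc : InLowerClosure lam' lamP) (hl : lam' ∈ T.Lam n) {f : A n} (hf : IsIdemFor f lam')
    {c : A (n + 1)} (hc : IsBlockIdem c (lamP.L (n + 1))) : IsIdemFor (c * T.ι n f) lamP := by
  have := hT.isArtinianRing n
  obtain ⟨d, hd⟩ := exists_isBlockIdem (R := A n) (lam'.L n)
  have hdf := hf.block_mul hd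
  obtain ⟨tauP, hU, hP⟩ := hlc.exists_isUpper lam'.mem_block_self
  obtain rfl := hP rfl
  have hlP := hU.mem_Lam hl
  have := isSimpleModule_L hlP
  have hcomm : Commute c (T.ι n f) := (Subring.mem_center_iff.1 hc.mem_center _).symm
  have hιf : IsIdempotentElem (T.ι n f) := hf.idem.map (T.ι n)
  refine ⟨IsIdempotentElem.mul_of_commute hcomm hc.idem hιf, fun L _ _ _ ⟨x, hx⟩ => ?_,
    fun L _ _ _ hL => ?_⟩
  · rw [mul_smul] at hx
    have hx0 : T.ι n f • x ≠ 0 := fun h0 => hx (by rw [h0, smul_zero])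
    obtain ⟨tau, ht⟩ := T.exists_labels (n + 1) L
    have hcL : ActsAsOne c L := by
      by_contra hn
      exact hx (smul_eq_zero_of_not_actsAsOne hc.mem_center hc.idem hn _)
    obtain ⟨g⟩ := ht.equiv_L
    have := isSimpleModule_L ht.1
    have htB := Weight.mem_block_of_actsAsOne hc hlP ht.1
      (hcL.of_injective g.toLinearMap g.injective)
    have hv : d • (show Res (T.ι n) L from T.ι n f • x) = T.ι n f • x := by
      change T.ι n d • T.ι n f • x = T.ι n f • x
      rw [smul_smul, ← map_mul, hdf]
    obtain ⟨V, hVs, hdV, hVl⟩ := exists_simple_le_of_fixed hT hloc hlc hl hd htB ht hx0 hv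
    have hmem : (show Res (T.ι n) L from T.ι n f • x) ∈ V := hv ▸ hdV _
    -- `f` is nonzero on the simple module `V`, so `V` is `L_n(λ')`, which forces the label of `L`
    -- to be `λ⁺`.
    rw [← hVl (hf.labels V ⟨⟨_, hmem⟩, fun h0 => hx0 ?_⟩)]
    · exact ht
    · have h1 := congrArg Subtype.val h0
      change T.ι n f • T.ι n f • x = 0 at h1
      rwa [smul_smul, hιf.eq] at h1
  · obtain ⟨g⟩ := hL.equiv_L
    have hcL : ActsAsOne c L := hc.acts.of_surjective g.toLinearMap g.surjective
    have hres := hU.labels_res hT hl hL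
    obtain ⟨v, hv0, -, hv⟩ := hres.exists_fixed hd.mem_center hd.idem hd.acts
    obtain ⟨V, hVs, hdV, -⟩ := exists_simple_le_of_fixed hT hloc hlc hl hd hU.exists_supp.1 hL hv0 hv
    have hV : lam'.Labels n V := by
      obtain ⟨h, hh⟩ := hres.exists_hom
      -- `Δ_n(λ')` lies in its block, so its image in `res L` falls into `V`.
      refine labels_of_ne_zero hl (f := h.codRestrict V fun y => ?_) fun h0 =>
        hh (LinearMap.ext fun y => congrArg Subtype.val (LinearMap.congr_fun h0 y))
      rw [← Extend.actsAsOne (S := lam'.cls.Rep) (isCorner_emb hl) hd.mem_center hd.idem hd.acts y,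
        map_smul]
      exact hdV _
    obtain ⟨⟨(x : L), hxV⟩, hx0, hfx, hx⟩ := hf.fixed V hV
    have hfx' : T.ι n f • x = x := congrArg Subtype.val hfx
    refine ⟨x, fun h0 => hx0 (Subtype.ext h0), ?_, fun y hy => ?_⟩
    · rw [mul_smul, hcL]
      exact hfx'
    · rw [mul_smul, hcL] at hy
      have hyd : d • (show Res (T.ι n) L from y) = y := by
        change T.ι n d • y = y
        rw [← hy, smul_smul, ← map_mul, hdf]
      have hyV : (show Res (T.ι n) L from y) ∈ V := hyd ▸ hdV _
      obtain ⟨a, ha⟩ := hx ⟨y, hyV⟩ (Subtype.ext hy)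
      refine ⟨a, (congrArg Subtype.val ha).trans ?_⟩
      change T.ι n (algebraMap k (A n) a) • x = _
      rw [AlgHom.commutes]

end TowerData


/-! ### From projective covers to idempotents and back -/

/-- `P` is generated by `p`, and `a f ↦ a p` is an isomorphism of `R f` onto `P`, where `f` is an
idempotent. -/
structure IsIdemGenerator {R : Type u} [Ring R] {P : Type v} [AddCommGroup P] [Module R P]
    (f : R) (p : P) : Prop where
  idem : IsIdempotentElem f
  smul_eq : f • p = p
  span : Submodule.span R {p} = ⊤
  mul_eq : ∀ a : R, a • p = 0 → a * f = 0

section OneAlgebra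

variable {R : Type u} [Ring R] {P : Type v} [AddCommGroup P] [Module R P] {f : R} {p : P}

theorem IsIdemGenerator.exists_smul (h : IsIdemGenerator f p) (x : P) : ∃ a : R, a • p = x :=
  Submodule.mem_span_singleton.1 (h.span ▸ Submodule.mem_top)

theorem IsIdemGenerator.exists_hom (h : IsIdemGenerator f p) {M : Type*} [AddCommGroup M]
    [Module R M] {y : M} (hy : f • y = y) : ∃ g : P →ₗ[R] M, g p = y := by
  have hs : Function.Surjective (LinearMap.toSpanSingleton R P p) := h.exists_smul
  refine ⟨((LinearMap.ker (LinearMap.toSpanSingleton R P p)).liftQ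
    (LinearMap.toSpanSingleton R M y) fun a ha => ?_) ∘ₗ
      ((LinearMap.toSpanSingleton R P p).quotKerEquivOfSurjective hs).symm.toLinearMap, ?_⟩
  · rw [LinearMap.mem_ker, LinearMap.toSpanSingleton_apply, ← hy, smul_smul, h.mul_eq a ha,
      zero_smul]
  · have h1 : ((LinearMap.toSpanSingleton R P p).quotKerEquivOfSurjective hs).symm p =
        Submodule.Quotient.mk 1 := (LinearEquiv.symm_apply_eq _).2 (one_smul R p).symm
    rw [LinearMap.comp_apply, LinearEquiv.coe_coe, h1]
    exact one_smul R y

theorem IsIdemGenerator.hom_ext (h : IsIdemGenerator f p) {M : Type*} [AddCommGroup M]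
    [Module R M] {g g' : P →ₗ[R] M} (hg : g p = g' p) : g = g' := by
  ext x
  obtain ⟨a, rfl⟩ := h.exists_smul x
  rw [map_smul, map_smul, hg]

theorem IsIdemGenerator.projective (h : IsIdemGenerator f p) : Module.Projective R P := by
  obtain ⟨g, hg⟩ := h.exists_hom (M := R) (y := f) h.idem.eq
  refine Module.Projective.of_split g (LinearMap.toSpanSingleton R P p) (h.hom_ext ?_)
  rw [LinearMap.comp_apply, hg, LinearMap.toSpanSingleton_apply, h.smul_eq, LinearMap.id_apply]

theorem IsProjectiveCover.exists_generator {L : Type w} [AddCommGroup L] [Module R L]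
    [IsSimpleModule R L] (h : IsProjectiveCover R P L) {e : R} (he : IsIdempotentElem e)
    (heL : ∃ x : L, e • x ≠ 0) :
    ∃ (f : R) (p : P), e * f = f ∧ f * e = f ∧ IsIdemGenerator f p := by
  obtain ⟨hproj, π, hπ, hsup⟩ := h
  obtain ⟨x, hx⟩ := heL
  obtain ⟨p, rfl⟩ := hπ x
  have hep : e • e • p = e • p := by rw [smul_smul, he.eq]
  have hspan : Submodule.span R {e • p} = ⊤ := by
    refine hsup _ (top_le_iff.1 fun y _ => ?_)
    rw [← map_smul] at hx
    obtain ⟨a, ha⟩ := IsSimpleModule.toSpanSingleton_surjective R hx (π y)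
    rw [LinearMap.toSpanSingleton_apply, ← map_smul] at ha
    rw [← add_sub_cancel (a • e • p) y]
    refine Submodule.add_mem_sup (Submodule.smul_mem _ _ (Submodule.mem_span_singleton_self _)) ?_
    rw [LinearMap.mem_ker, map_sub, ha, sub_self]
  have hs : Function.Surjective (LinearMap.toSpanSingleton R P (e • p)) := fun y =>
    Submodule.mem_span_singleton.1 (hspan ▸ Submodule.mem_top)
  obtain ⟨s, hsec⟩ := Module.projective_lifting_property _ LinearMap.id hs
  have hsec' : ∀ y, s y • e • p = y := fun y => LinearMap.congr_fun hsec y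
  have hes : e * s (e • p) = s (e • p) := by rw [← smul_eq_mul, ← map_smul, hep]
  have hfp : (s (e • p) * e) • e • p = e • p := by rw [mul_smul, hep, hsec']
  -- `s` splits `a ↦ a • e • p`. The right factor `e` places the idempotent in the corner `eRe`
  -- without changing its action on `e • p`.
  refine ⟨s (e • p) * e, e • p, ?_, ?_, ?_, hfp, hspan, fun a ha => ?_⟩
  · rw [← mul_assoc, hes]
  · rw [mul_assoc, he.eq]
  · rw [IsIdempotentElem, mul_assoc, ← mul_assoc e, hes, ← mul_assoc]
    congr 1
    rw [← smul_eq_mul, ← map_smul, hsec']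
  · rw [← mul_assoc, ← smul_eq_mul a, ← map_smul, ha, map_zero, zero_mul]

theorem IsIdemGenerator.blockPart {L : Type w} [AddCommGroup L] [Module R L] {c : R}
    (hc : IsBlockIdem c L) (h : IsIdemGenerator f p) :
    ∃ q : blockPart R L P, IsIdemGenerator (c * f) q := by
  have hcomm : ∀ a, a * c = c * a := Subring.mem_center_iff.1 hc.mem_center
  refine ⟨⟨c • p, hc.mem_blockPart.2 (smul_smul_idem hc.idem p)⟩,
    IsIdempotentElem.mul_of_commute (hcomm f).symm hc.idem h.idem, Subtype.ext ?_, ?_,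
    fun a ha => ?_⟩
  · change (c * f) • c • p = c • p
    rw [smul_smul_central hc.mem_center (c * f) p |>.symm, mul_smul, h.smul_eq,
      smul_smul_idem hc.idem]
  · refine top_le_iff.1 fun y _ => ?_
    obtain ⟨a, ha⟩ := h.exists_smul y.1
    refine Submodule.mem_span_singleton.2 ⟨a, Subtype.ext ?_⟩
    change a • c • p = y.1
    rw [← smul_smul_central hc.mem_center, ha, hc.mem_blockPart.1 y.2]
  · rw [← mul_assoc]
    refine h.mul_eq _ ?_
    rw [mul_smul]
    exact congrArg Subtype.val ha

end OneAlgebra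

theorem exists_eq_algebraMap_smul {k : Type w} [Field k] [IsAlgClosed k] {R : Type u} [Ring R]
    [Algebra k R] [Module.Finite k R] {L : Type v} [AddCommGroup L] [Module R L]
    [IsSimpleModule R L] (θ : L →ₗ[R] L) : ∃ a : k, ∀ x, θ x = algebraMap k R a • x := by
  let _ : Module k L := Module.compHom L (algebraMap k R)
  have hsm : ∀ (a : k) (x : L), a • x = algebraMap k R a • x := fun _ _ => rfl
  have : IsScalarTower k R L := ⟨fun a r x => by rw [hsm, Algebra.smul_def, mul_smul]⟩
  have : Module.Finite k L := Module.Finite.trans R L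
  obtain ⟨a, rfl⟩ := (IsSimpleModule.algebraMap_end_bijective_of_isAlgClosed (A := R) (V := L) k).2 θ
  exact ⟨a, fun x => rfl⟩

namespace TowerData

variable {k : Type w} [Field k] {A : ℕ → Type u} [∀ n, Ring (A n)] [∀ n, Algebra k (A n)]
  {T : TowerData k A} {n : ℕ} {lam : T.Weight} {P : Type v} [AddCommGroup P]

theorem IsIdemFor.of_isP [IsAlgClosed k] (hT : T.IsTowerOfRecollement) [Module (A n) P]
    (h : lam.IsP n P) {f : A n} {p : P} (hp : IsIdemGenerator f p) : IsIdemFor f lam := by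
  obtain ⟨hl, -, π, hπ, hsup⟩ := h
  have := isSimpleModule_L hl
  have := hT.finite n
  -- A superfluous kernel of a map onto a simple module is the only maximal submodule of `P`.
  have hker : ∀ {L : Type u} [AddCommGroup L] [Module (A n) L] [IsSimpleModule (A n) L]
      (g : P →ₗ[A n] L), Function.Surjective g → LinearMap.ker g = LinearMap.ker π := by
    intro L _ _ _ g hg
    have hgc := LinearMap.isCoatom_ker_of_surjective hg
    have hπc := LinearMap.isCoatom_ker_of_surjective hπ
    by_contra hne
    refine hgc.1 (hsup _ (hgc.2 _ (lt_of_le_of_ne le_sup_left fun heq => hne ?_)))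
    exact ((hπc.le_iff_eq hgc.1).1 (heq ▸ le_sup_right))
  refine ⟨hp.idem, fun L _ _ _ ⟨x, hx⟩ => ?_, fun L _ _ _ hL => ?_⟩
  · obtain ⟨g, hg⟩ := hp.exists_hom (y := f • x) (by rw [smul_smul, hp.idem.eq])
    have hgs : Function.Surjective g :=
      LinearMap.surjective_of_ne_zero fun h0 => hx (by rw [← hg, h0]; rfl)
    let E : lam.L n ≃ₗ[A n] L := (π.quotKerEquivOfSurjective hπ).symm.trans
      ((Submodule.quotEquivOfEq _ _ (hker g hgs).symm).trans (g.quotKerEquivOfSurjective hgs))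
    exact (labels_L hl).map E.toLinearMap E.injective
  · obtain ⟨E⟩ := hL.equiv_L
    let π' : P →ₗ[A n] L := E.toLinearMap ∘ₗ π
    have hπ' : Function.Surjective π' := E.surjective.comp hπ
    refine ⟨π' p, fun h0 => ?_, by rw [← map_smul, hp.smul_eq], fun y hy => ?_⟩
    · have h1 : π' = 0 := hp.hom_ext h0
      have := IsSimpleModule.nontrivial (A n) L
      obtain ⟨x, hx⟩ := exists_ne (0 : L)
      obtain ⟨z, rfl⟩ := hπ' x
      exact hx (by rw [h1]; rfl)
    · obtain ⟨g, rfl⟩ := hp.exists_hom hy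
      have hle : LinearMap.ker π' ≤ LinearMap.ker g := by
        by_cases h0 : g = 0
        · rw [h0, LinearMap.ker_zero]
          exact le_top
        · rw [hker π' hπ', hker g (LinearMap.surjective_of_ne_zero h0)]
      -- Maps `P → L` correspond to vectors fixed by `f`. All of them factor through `π'`, so by
      -- Schur's lemma they are scalar multiples of it.
      obtain ⟨a, ha⟩ := exists_eq_algebraMap_smul (k := k)
        (((LinearMap.ker π').liftQ g hle) ∘ₗ (π'.quotKerEquivOfSurjective hπ').symm.toLinearMap)
      refine ⟨a, ?_⟩
      rw [← ha, LinearMap.comp_apply, LinearEquiv.coe_coe,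
        show π' p = π'.quotKerEquivOfSurjective hπ' (Submodule.Quotient.mk p) from rfl,
        LinearEquiv.symm_apply_apply]
      rfl

theorem IsIdemFor.isP [Module (A n) P] (hl : lam ∈ T.Lam n) {f : A n} (hf : IsIdemFor f lam)
    {p : P} (hp : IsIdemGenerator f p) : lam.IsP n P := by
  have := isSimpleModule_L hl
  refine ⟨hl, hp.projective, ?_⟩
  obtain ⟨x, hx0, hfx, -⟩ := hf.fixed _ (labels_L hl)
  obtain ⟨π, hπ⟩ := hp.exists_hom hfx
  refine ⟨π, LinearMap.surjective_of_ne_zero fun h0 => hx0 (by rw [← hπ, h0]; rfl),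
    fun N hN => ?_⟩
  by_contra hne
  -- A proper `N` gives a simple quotient `A n ⧸ J` of `P` that kills `N`. It is `L(lam)`, and since
  -- `f` fixes only a line there, this quotient map is proportional to `π`; then `N ⊔ ker π` cannot
  -- contain `p`.
  obtain ⟨J, hIJ, hJ, hfJ, hJ0⟩ := exists_simple_of_ideal (g := f)
    (I := N.comap (LinearMap.toSpanSingleton (A n) P p)) (fun htop => hne (top_le_iff.1 fun y _ => by
      obtain ⟨a, rfl⟩ := hp.exists_smul y
      exact (show a ∈ N.comap (LinearMap.toSpanSingleton (A n) P p) from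
        htop ▸ Submodule.mem_top))) (by
      change (1 - f) • p ∈ N
      rw [sub_smul, one_smul, hp.smul_eq, sub_self]
      exact N.zero_mem)
  have hJl := hf.labels _ ⟨_, fun h0 => hJ0 (hfJ.symm.trans h0)⟩
  obtain ⟨E⟩ := hJl.equiv_L
  obtain ⟨x', hx0', -, hx'⟩ := hf.fixed _ (labels_L hl)
  obtain ⟨a, ha⟩ := hx' x hfx
  obtain ⟨b, hb⟩ := hx' (E.symm (Submodule.Quotient.mk 1)) (by rw [← map_smul, hfJ])
  have hb0 : b ≠ 0 := by
    rintro rfl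
    rw [map_zero, zero_smul, LinearEquiv.map_eq_zero_iff] at hb
    exact hJ0 hb
  obtain ⟨y, hy, z, hz, hyz⟩ := Submodule.mem_sup.1 (hN ▸ Submodule.mem_top : p ∈ N ⊔ LinearMap.ker π)
  have hx'' : x = algebraMap k (A n) (a * b⁻¹) • E.symm (Submodule.Quotient.mk 1) := by
    rw [hb, smul_smul, ← map_mul, mul_assoc, inv_mul_cancel₀ hb0, mul_one, ha]
  obtain ⟨r, rfl⟩ := hp.exists_smul y
  have h1 : r • (Submodule.Quotient.mk 1 : A n ⧸ J) = 0 := by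
    rw [← Submodule.Quotient.mk_smul, smul_eq_mul, mul_one]
    exact (Submodule.Quotient.mk_eq_zero J).2 (hIJ hy)
  refine hx0 ?_
  rw [← hπ, ← hyz, map_add, LinearMap.mem_ker.1 hz, add_zero, map_smul, hπ, hx'', smul_smul,
    ← Algebra.commutes, ← smul_smul, ← map_smul, h1, map_zero, smul_zero]

theorem IsIdemGenerator.ind [Module k P] [Module (A n) P] [IsScalarTower k (A n) P] {f : A n}
    {p : P} (h : IsIdemGenerator f p) : ∃ q : T.Ind n P, IsIdemGenerator (T.ι n f) q := by
  let φ : A n →ₙₐ[k] A (n + 1) := T.ι n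
  have hφ : ∀ a, φ a = T.ι n a := fun _ => rfl
  have hφ1 : φ 1 = 1 := map_one (T.ι n)
  refine ⟨Extend.of φ p, h.idem.map (T.ι n), ?_, ?_, fun a ha => ?_⟩
  · rw [← hφ, ← Extend.of_smul, h.smul_eq]
  · refine top_le_iff.1 fun y _ => ?_
    induction y using Extend.induction φ with
    | h a x =>
      obtain ⟨b, rfl⟩ := h.exists_smul x
      rw [← Extend.mk_mul, Extend.mk_eq]
      exact Submodule.smul_mem _ _ (Submodule.mem_span_singleton_self _)
    | hadd y z hy hz => exact Submodule.add_mem _ (hy trivial) (hz trivial)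
  · obtain ⟨s, hs⟩ := h.exists_hom (M := A n) (y := f) h.idem.eq
    let g : P →+ A (n + 1) := (T.ι n).toRingHom.toAddMonoidHom.comp s.toAddMonoidHom
    have hg : ∀ b x, g (b • x) = φ b • g x := fun b x => by
      change T.ι n (s (b • x)) = T.ι n b * T.ι n (s x)
      rw [map_smul, smul_eq_mul, map_mul]
    have h1 := congrArg (Extend.lift g hg) ha
    rw [map_smul, Extend.lift_of, map_zero] at h1
    rw [← hs]
    exact h1

/-- Under `A_{n+2} e ≅ A_{n+1}`, right multiplication by `Φ f` becomes right multiplication by `ι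
f`; the generator is `u • p`. -/
theorem IsIdemGenerator.res (hT : T.IsTowerOfRecollement) [Module (A (n + 2)) P] {f : A n}
    {p : P} (h : IsIdemGenerator (T.Φ n f) p) :
    ∃ q : Res (T.ι (n + 1)) P, IsIdemGenerator (T.ι n f) q := by
  obtain ⟨u, β, h1, h2, h3, hu, hc⟩ := hT.exists_bimodule n
  have hf : IsIdempotentElem f := T.Φ_injective n (by rw [map_mul, h.idem.eq])
  have hep : T.e n • p = p := by rw [← h.smul_eq, ← T.Φ_one, smul_smul, map_one_mul]
  refine ⟨(u • p : P), hf.map (T.ι n), ?_, ?_, fun a ha => ?_⟩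
  · change T.ι (n + 1) (T.ι n f) • u • p = u • p
    rw [smul_smul, ← hc, mul_smul, h.smul_eq]
  · refine top_le_iff.1 fun y _ => ?_
    obtain ⟨b, hb⟩ := h.exists_smul (show P from y)
    refine Submodule.mem_span_singleton.2 ⟨β b, ?_⟩
    change T.ι (n + 1) (β b) • u • p = _
    rw [smul_smul, hu, mul_smul, hep, hb]
  · have h4 : (T.ι (n + 1) a * u) * T.Φ n f = 0 := h.mul_eq _ (by rw [mul_smul]; exact ha)
    have h5 := congrArg β h4
    rwa [h3, h2, h1, mul_one, map_zero] at h5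

theorem Weight.Labels.equiv_corner {L : Type v} [AddCommGroup L] [Module (A n) L]
    [IsSimpleModule (A n) L] (h : lam.Labels n L) :
    Nonempty (Recollement.corner (T.Φ n) (lam.L (n + 2)) ≃ₗ[A n] L) := by
  have hl := mem_Lam_add_two h.1
  have := isSimpleModule_L hl
  have := isSimpleModule_corner (T.isCorner_Φ n) ((labels_L hl).exists_e_smul h.1)
  obtain ⟨E⟩ := ((labels_L hl).corner h.1).equiv_L
  obtain ⟨E'⟩ := h.equiv_L
  exact ⟨E.symm.trans E'⟩

set_option maxHeartbeats 1000000 in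
theorem IsIdemFor.of_Φ (hl : lam ∈ T.Lam n) {f : A n} (h : IsIdemFor (T.Φ n f) lam) :
    IsIdemFor f lam := by
  refine ⟨T.Φ_injective n (by rw [map_mul, h.idem.eq]), fun L _ _ _ ⟨x, hx⟩ => ?_,
    fun L _ _ _ hL => ?_⟩
  · obtain ⟨tau, ht⟩ := T.exists_labels n L
    obtain ⟨E⟩ := ht.equiv_corner
    have ht2 := mem_Lam_add_two ht.1
    have := isSimpleModule_L ht2
    have h1 := h.labels (tau.L (n + 2)) ⟨(E.symm x).1, fun h0 => hx (E.symm.injective ?_)⟩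
    · exact ((h1.corner hl).map E.toLinearMap E.injective)
    · rw [map_smul, map_zero]
      exact Subtype.ext h0
  · obtain ⟨E⟩ := hL.equiv_corner
    have hl2 := mem_Lam_add_two hl
    have := isSimpleModule_L hl2
    obtain ⟨x, hx0, hfx, hx⟩ := h.fixed _ (labels_L hl2)
    have hmem : T.Φ n 1 • x = x := by rw [← hfx, smul_smul, map_one_mul]
    let x' : corner (T.Φ n) (lam.L (n + 2)) := ⟨x, hmem⟩
    refine ⟨E x', fun h0 => hx0 ?_, ?_, fun y hy => ?_⟩
    · exact congrArg Subtype.val ((LinearEquiv.map_eq_zero_iff E).1 h0)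
    · rw [← map_smul]
      exact congrArg E (Subtype.ext hfx)
    · obtain ⟨z, rfl⟩ := E.surjective y
      rw [← map_smul] at hy
      obtain ⟨a, ha⟩ := hx z.1 (congrArg Subtype.val (E.injective hy))
      have h1 : T.Φ n (algebraMap k (A n) a) = algebraMap k (A (n + 2)) a * T.Φ n 1 := by
        rw [Algebra.algebraMap_eq_smul_one, map_smul, Algebra.smul_def]
      have h2 : z.1 = T.Φ n (algebraMap k (A n) a) • x := by
        rw [h1, mul_smul, hmem]
        exact ha
      refine ⟨a, ?_⟩
      exact (congrArg E (Subtype.ext h2)).trans (map_smul E _ x')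

end TowerData

end Recollement

theorem proposition3p4 {k : Type w} [Field k] [IsAlgClosed k] {A : ℕ → Type u}
    [∀ n, Ring (A n)] [∀ n, Algebra k (A n)] (T : Recollement.TowerData k A)
    (hT : T.IsTowerOfRecollement) (lam' lamP : T.Weight)
    (hloc : Recollement.TowerData.EnoughLocalHoms lamP lam')
    (hlc : Recollement.TowerData.InLowerClosure lam' lamP) :
    (∀ n, lam' ∈ T.Lam n →
      ∀ (P : Type v) [AddCommGroup P] [Module k P] [Module (A n) P] [IsScalarTower k (A n) P],
        lam'.IsP n P → lamP.IsP (n + 1) (lamP.indTr n P)) ∧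
    (∀ n, lam' ∈ T.Lam n →
      ∀ (P : Type v) [AddCommGroup P] [Module (A (n + 2)) P],
        lam'.IsP (n + 2) P → lamP.IsP (n + 1) (lamP.resTr (n + 1) P)) := by
  obtain ⟨tauP, hU, hP⟩ := hlc.exists_isUpper lam'.mem_block_self
  obtain rfl := hP rfl
  refine ⟨fun n hl P _ _ _ _ h => ?_, fun n hl P _ _ h => ?_⟩
  all_goals
    have := hT.isArtinianRing (n + 1)
    have hlP := hU.mem_Lam hl
    obtain ⟨c, hc⟩ := Recollement.exists_isBlockIdem (R := A (n + 1)) (tauP.L (n + 1))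
  · have := Recollement.TowerData.isSimpleModule_L hl
    have := IsSimpleModule.nontrivial (A n) (lam'.L n)
    obtain ⟨x, hx⟩ := exists_ne (0 : lam'.L n)
    obtain ⟨f, p, -, -, hp⟩ := h.2.exists_generator IsIdempotentElem.one ⟨x, by rwa [one_smul]⟩
    have hf := Recollement.TowerData.IsIdemFor.of_isP hT h hp
    obtain ⟨q, hq⟩ := Recollement.TowerData.IsIdemGenerator.ind (T := T) hp
    obtain ⟨r, hr⟩ := hq.blockPart hc
    exact (hf.translate hT hloc hlc hl hc).isP hlP hr
  · have hl2 := Recollement.TowerData.mem_Lam_add_two hl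
    have := Recollement.TowerData.isSimpleModule_L hl2
    -- The corner idempotent is nonzero on `L_{n+2}(λ')` because `λ' ∈ Λ_n`, so `f` can be taken in
    -- the image of `Φ`.
    obtain ⟨f, p, h1, h2, hp⟩ := h.2.exists_generator (e := T.Φ n 1)
      (by rw [IsIdempotentElem, ← map_mul, one_mul])
      ((Recollement.TowerData.labels_L hl2).exists_e_smul hl)
    obtain ⟨f', rfl⟩ : ∃ f', T.Φ n f' = f := by
      obtain ⟨f', hf'⟩ := (T.isCorner_Φ n).corner f
      exact ⟨f', by rw [hf', h1, h2]⟩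
    have hf := (Recollement.TowerData.IsIdemFor.of_isP hT h hp).of_Φ hl
    obtain ⟨q, hq⟩ := Recollement.TowerData.IsIdemGenerator.res hT hp
    obtain ⟨r, hr⟩ := hq.blockPart hc
    exact (hf.translate hT hloc hlc hl hc).isP hlP hr
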